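/- Let $R$ be a commutative ring and let $\mathcal C$ be an $R$-linear symmetric monoidal category, with symmetry $\sigma$ and unit $1$, which is $\otimes$-cocomplete (it has all small colimits and $\otimes$ preserves them in each variable). Let $Q$ be a finite quiver, $\overline Q$ its double, with involution $a\mapsto\overline a$ on arrows, and let $\langle a,b\rangle$ be $1$ if $a\in Q_1$ and $b=\overline a$, $-1$ if $b\in Q_1$ and $a=\overline b$, and $0$ otherwise. For each vertex $i$ let $c_i\in\mathcal C$ be a dualisable object, with dual $c_i^\vee$, evaluation $c_i^\vee\otimes c_i\to 1$ and coevaluation $\mathrm{coev}_i\colon 1\to c_i\otimes c_i^\vee$. For an arrow $a$ of $\overline Q$ put $h_a^\vee=c_{s(a)}\otimes c_{t(a)}^\vee$, and let $h^\vee=\bigoplus_{a\in\overline Q_1}h_a^\vee$. For a commutative monoid $A$ in $\mathcal C$ with multiplication $\mu$ and a map $f\colon Z\otimes A\to A$, let $T(f)\colon A\otimes Z\otimes A\to A$ be the commutator of $f$ with multiplication in the last variable, written in elements as $T(f)(x,z,y)=f(z,xy)-x\,f(z,y)$. A map $B\colon A\otimes A\to A$ is a bi-derivation if it vanishes when the unit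 of $A$ is inserted in either variable and has order $\le 1$ in each variable, i.e. $T^2=0$ with respect to that variable. It is a Poisson bracket if moreover $B\circ\sigma_{A,A}=-B$ and $B\circ(\mathrm{id}_A\otimes B)\circ\mathfrak S_3=0$, where $\mathfrak S_3$ is the sum of the three cyclic permutations of $A^{\otimes 3}$. Then the free commutative monoid $Sh^\vee$ on $h^\vee$ (initial among commutative monoids in $\mathcal C$ equipped with a map from $h^\vee$) exists, and there is a unique bi-derivation $\{-,-\}^+\colon Sh^\vee\otimes Sh^\vee\to Sh^\vee$ whose restriction to $h_a^\vee\otimes h_b^\vee$, for all arrows $a,b$ of $\overline Q$, is as follows. It is $0$ if $b\ne\overline a$. If $b=\overline a$, with $h_a^\vee=c_i\otimes c_j^\vee$ and $h_b^\vee=c_j\otimes c_i^\vee$, it is $\langle a,b\rangle$ times the composite $$h_a^\vee\otimes h_b^\vee\longrightarrow h_a^\vee\otimes h_a^\vee\otimes h_b^\vee\otimes h_b^\vee\longrightarrow Sh^\vee,$$ where the second map is induced by multiplication and the first inserts $\mathrm{coev}_i$ and $\mathrm{coev}_j$: writing symbolically $\mathrm{coev}_i=\sum_l e_l\otimes e_l^\vee$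 and $\mathrm{coev}_j=\sum_k e'_k\otimes e_k'^\vee$, it is $$v\otimes\xi\otimes w\otimes\zeta\longmapsto\sum_{k,l}(v\otimes e_k'^\vee)\otimes(e_l\otimes\xi)\otimes(w\otimes e_l^\vee)\otimes(e'_k\otimes\zeta).$$ Moreover $\{-,-\}^+$ is a Poisson bracket, i.e. $(Sh^\vee,\{-,-\}^+)$ is a Poisson algebra in $\mathcal C$. -/

import Mathlib

open CategoryTheory MonoidalCategory Limits MonObj

noncomputable section

namespace QuarticPoisson

universe v u

/-! ### Bi-derivations and Poisson algebras in a linear symmetric monoidal category -/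

section Poisson

variable {C : Type u} [Category.{v} C] [MonoidalCategory C] [SymmetricCategory C]
  [Preadditive C]

/-- The operator `T`: the commutator of a map `f : z ⊗ a ⟶ a` with multiplication in its last
variable, `(T f)(x, z, y) = f(z, x y) - x f(z, y)`. The object `z` collects the variables of `f`
other than the distinguished last one. -/
def opT {z a : C} [MonObj a] (f : z ⊗ a ⟶ a) : (a ⊗ z) ⊗ a ⟶ a :=
  (β_ a z).hom ▷ a ≫ (α_ z a a).hom ≫ z ◁ μ[a] ≫ f - (α_ a z a).hom ≫ a ◁ f ≫ μ[a]

/-- `f : z ⊗ a ⟶ a` is a differential operator of order `≤ k` in its last variable: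
`T ^ (k + 1) f = 0`. -/
def HasOrderLE {a : C} [MonObj a] : ℕ → ∀ {z : C}, (z ⊗ a ⟶ a) → Prop
  | 0, _, f => opT f = 0
  | k + 1, _, f => HasOrderLE k (opT f)

/-- `B : a ⊗ a ⟶ a` is a bi-differential operator of order `(k₁, k₂)`. -/
structure IsBiDiffOp {a : C} [MonObj a] (k₁ k₂ : ℕ) (B : a ⊗ a ⟶ a) : Prop where
  order_fst : HasOrderLE k₁ ((β_ a a).hom ≫ B)
  order_snd : HasOrderLE k₂ B

/-- A bi-derivation: a bi-differential operator of order `(1, 1)` vanishing on the unit in each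
variable. -/
structure IsBiDerivation {a : C} [MonObj a] (B : a ⊗ a ⟶ a) : Prop extends
    IsBiDiffOp 1 1 B where
  unit_fst : η[a] ▷ a ≫ B = 0
  unit_snd : a ◁ η[a] ≫ B = 0

/-- The cyclic permutation `x ⊗ (y ⊗ z) ↦ y ⊗ (z ⊗ x)`. -/
def cyc (a : C) : a ⊗ (a ⊗ a) ⟶ a ⊗ (a ⊗ a) :=
  (β_ a (a ⊗ a)).hom ≫ (α_ a a a).hom

/-- The cyclic symmetriser on three copies of `a`. -/
def cyclicSymmetriser (a : C) : a ⊗ (a ⊗ a) ⟶ a ⊗ (a ⊗ a) :=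
  𝟙 _ + cyc a + cyc a ≫ cyc a

/-- `B` is a Poisson bracket on the commutative monoid `a`, i.e. `(a, B)` is a Poisson algebra. -/
structure IsPoissonBracket {a : C} [MonObj a] [IsCommMonObj a] (B : a ⊗ a ⟶ a) : Prop where
  biDerivation : IsBiDerivation B
  antisymm : (β_ a a).hom ≫ B = -B
  jacobi : cyclicSymmetriser a ≫ a ◁ B ≫ B = 0

end Poisson

/-- The commutative monoid `S` with the map `inc : x ⟶ S` is the free commutative monoid on `x`:
it is initial among commutative monoids equipped with a map from `x`. -/
def IsFreeCommMon {C : Type u} [Category.{v} C] [MonoidalCategory C] [SymmetricCategory C]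
    {x S : C} [MonObj S] [IsCommMonObj S] (inc : x ⟶ S) : Prop :=
  ∀ (A : C) [MonObj A] [IsCommMonObj A] (f : x ⟶ A), ∃! g : S ⟶ A, IsMonHom g ∧ inc ≫ g = f

/-! ### The double quiver -/

section DoubleQuiver

variable (V : Type*) [Quiver V]

/-- The arrows of the double of the quiver `V` (its symmetrification). -/
abbrev DoubleArrow : Type _ := Quiver.Total (Quiver.Symmetrify V)

instance [Finite V] [∀ i j : V, Finite (i ⟶ j)] : Finite (DoubleArrow V) := by
  let g : DoubleArrow V → Σ p : V × V, (p.1 ⟶ p.2) ⊕ (p.2 ⟶ p.1) :=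
    fun a => ⟨(a.left, a.right), a.hom⟩
  refine Finite.of_injective g ?_
  rintro ⟨i, j, e⟩ ⟨i', j', e'⟩ h
  simp only [g, Sigma.mk.injEq] at h
  obtain ⟨⟨rfl, rfl⟩, h⟩ := h
  obtain rfl := eq_of_heq h
  rfl

variable {V}

namespace DoubleArrow

/-- The source of an arrow of the double quiver. -/
abbrev src (a : DoubleArrow V) : V := a.left

/-- The target of an arrow of the double quiver. -/
abbrev tgt (a : DoubleArrow V) : V := a.right

/-- The involution on the arrows of the double quiver. -/
abbrev bar (a : DoubleArrow V) : DoubleArrow V := ⟨a.right, a.left, Quiver.reverse a.hom⟩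

/-- The arrow belongs to the original quiver. -/
def IsOriginal (a : DoubleArrow V) : Prop :=
  ∃ (i j : V) (e : i ⟶ j), a = ⟨i, j, Quiver.Hom.toPos e⟩

open Classical in
/-- The canonical antisymmetric pairing on the arrows of the double quiver. -/
def pairing (a b : DoubleArrow V) : ℤ :=
  if a.IsOriginal ∧ b = a.bar then 1
  else if b.IsOriginal ∧ a = b.bar then -1
  else 0

end DoubleArrow

end DoubleQuiver

/-! ### The dual of the representation variety and the quartic bracket on generators -/

section Representation

variable {V : Type*} [Quiver V] {C : Type u} [Category.{v} C] [MonoidalCategory C]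

/-- `h_aᵛ = c_{s(a)} ⊗ c_{t(a)}ᵛ`. -/
abbrev hDualAt (c : V → C) [∀ i, HasRightDual (c i)] (a : DoubleArrow V) : C :=
  c a.src ⊗ (c a.tgt)ᘁ

instance [Preadditive C] [HasColimits C] : HasFiniteBiproducts C :=
  HasFiniteBiproducts.of_hasFiniteCoproducts

/-- `hᵛ`, the biproduct of the `h_aᵛ` over all arrows `a` of the double quiver. -/
abbrev hDual [Preadditive C] [HasColimits C] [Finite V] [∀ i j : V, Finite (i ⟶ j)]
    (c : V → C) [∀ i, HasRightDual (c i)] : C :=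
  ⨁ fun a : DoubleArrow V => hDualAt c a

variable [SymmetricCategory C]

/-- The two coevaluations of `x` and `y`, arranged as
`∑ e_kᵛ ⊗ e_l ⊗ e_lᵛ ⊗ e_k` where `∑ e_k ⊗ e_kᵛ` and `∑ e_l ⊗ e_lᵛ` denote the coevaluations of
`y` and of `x`. -/
def coevPair (x y : C) [HasRightDual x] [HasRightDual y] : 𝟙_ C ⟶ (yᘁ ⊗ x) ⊗ (xᘁ ⊗ y) :=
  (λ_ (𝟙_ C)).inv ≫ (η_ y yᘁ ⊗ₘ η_ x xᘁ) ≫ (α_ y yᘁ (x ⊗ xᘁ)).hom ≫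
    (β_ y (yᘁ ⊗ (x ⊗ xᘁ))).hom ⊗≫ 𝟙 ((yᘁ ⊗ x) ⊗ (xᘁ ⊗ y))

/-- The map `(x ⊗ yᵛ) ⊗ (y ⊗ xᵛ) ⟶ (x ⊗ yᵛ) ⊗ (x ⊗ yᵛ) ⊗ (y ⊗ xᵛ) ⊗ (y ⊗ xᵛ)` built from
coevaluations; in the notation above it is
`v ⊗ ξ ⊗ w ⊗ ζ ↦ ∑ (v ⊗ e_kᵛ) ⊗ (e_l ⊗ ξ) ⊗ (w ⊗ e_lᵛ) ⊗ (e_k ⊗ ζ)`. -/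
def insertCoev (x y : C) [HasRightDual x] [HasRightDual y] :
    (x ⊗ yᘁ) ⊗ (y ⊗ xᘁ) ⟶ ((x ⊗ yᘁ) ⊗ (x ⊗ yᘁ)) ⊗ ((y ⊗ xᘁ) ⊗ (y ⊗ xᘁ)) :=
  𝟙 ((x ⊗ yᘁ) ⊗ (y ⊗ xᘁ)) ⊗≫
    x ◁ coevPair x y ▷ (yᘁ ⊗ y) ▷ xᘁ ⊗≫
    x ◁ (yᘁ ⊗ x) ◁ (β_ (xᘁ ⊗ y) (yᘁ ⊗ y)).hom ▷ xᘁ ⊗≫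
    𝟙 (((x ⊗ yᘁ) ⊗ (x ⊗ yᘁ)) ⊗ ((y ⊗ xᘁ) ⊗ (y ⊗ xᘁ)))

/-- The four-fold multiplication of a monoid. -/
def mul₄ (S : C) [MonObj S] : (S ⊗ S) ⊗ (S ⊗ S) ⟶ S :=
  (μ[S] ⊗ₘ μ[S]) ≫ μ[S]

variable [Preadditive C] [HasColimits C] [Finite V] [∀ i j : V, Finite (i ⟶ j)]
  (c : V → C) [∀ i, HasRightDual (c i)]

/-- The map `h_aᵛ ⟶ hᵛ ⟶ S` determined by `inc : hᵛ ⟶ S`. -/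
def gen {S : C} (inc : hDual c ⟶ S) (a : DoubleArrow V) : hDualAt c a ⟶ S :=
  biproduct.ι (fun a : DoubleArrow V => hDualAt c a) a ≫ inc

/-- For `b` the double of `a`, the map
`h_aᵛ ⊗ h_bᵛ ⟶ h_aᵛ ⊗ h_aᵛ ⊗ h_bᵛ ⊗ h_bᵛ ⟶ S` built from coevaluations. -/
def quarticAt {S : C} [MonObj S] (inc : hDual c ⟶ S) (a : DoubleArrow V) :
    hDualAt c a ⊗ hDualAt c a.bar ⟶ S :=
  insertCoev (c a.src) (c a.tgt) ≫
    ((gen c inc a ⊗ₘ gen c inc a) ⊗ₘ (gen c inc a.bar ⊗ₘ gen c inc a.bar)) ≫ mul₄ S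

open Classical in
/-- The `ab`-th component `h_aᵛ ⊗ h_bᵛ ⟶ S` of the quartic bracket: it is `⟨a, b⟩` times the map
built from coevaluations if `a` and `b` are in involution, and zero otherwise. -/
def quarticComponent {S : C} [MonObj S] (inc : hDual c ⟶ S) (a b : DoubleArrow V) :
    hDualAt c a ⊗ hDualAt c b ⟶ S :=
  if h : b = a.bar then
    a.pairing b • (eqToHom (by rw [h]) ≫ quarticAt c inc a)
  else 0

/-- `B : S ⊗ S ⟶ S` is the quartic bi-derivation: the bi-derivation whose restriction along
`h_aᵛ ⊗ h_bᵛ ⟶ S ⊗ S` is the `ab`-th component above, for all arrows `a` and `b`. -/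
structure IsQuarticBracket {S : C} [MonObj S] (inc : hDual c ⟶ S) (B : S ⊗ S ⟶ S) : Prop where
  biDerivation : IsBiDerivation B
  component : ∀ a b : DoubleArrow V,
    (gen c inc a ⊗ₘ gen c inc b) ≫ B = quarticComponent c inc a b

end Representation

end QuarticPoisson

end

/-! The computation is done with elements. A generalized element of `X` is a map `G ⟶ X` from a
cocommutative comonoid `G`; the comultiplication lets several elements share one parameter `G`.
Every `X` is a split quotient of the cocommutative comonoid `1 ⊞ X` in which `X` is primitive, so
maps out of tensor products are equal once they agree on tuples of generalized elements (`pair_ext`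
and its variants). For a commutative monoid `S` the maps `G ⟶ S` form a commutative ring under
convolution, so identities between maps into `S` become ring identities.

The free commutative monoid is a colimit of tensor words along associativity, unit and symmetry.
Because `⊗` preserves this colimit, a derivation out of it is freely determined by its values on
generators: the Leibniz rule defines it on words. Applied in each variable, this gives existence and
uniqueness of the bi-derivation. The failure of antisymmetry is again a bi-derivation, and the
Jacobiator of an antisymmetric bracket is a derivation in each variable, so both axioms need
checking only on generators.

There, regard `h_aᵛ ⟶ S` and `h_bᵛ ⟶ S`, `b = ā`, as matrices `A` and `B` with entries in `S`. The
bracket is `{A(p,p'), B(q,q')} = n (AB)(p,q') (BA)(q,p')` (`pair_insertCoev`). Exchanging the two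
factors and using `⟨b,a⟩ = -⟨a,b⟩` gives antisymmetry. For Jacobi, `{A(p,p'), {A(q,q'), B(r,r')}}`
equals `n²` times `(AB)(q,r') (BA)(r,p') (ABA)(p,q') + (AB)(p,r') (BA)(r,q') (ABA)(q,p')`, which is
symmetric under exchange of the two copies of `A`; as `{A, A} = 0`, the Jacobiator vanishes
(`pair_jacobiator_eq_zero`). If no such coincidence of arrows occurs, every term vanishes by itself.
-/

noncomputable section

namespace QuarticPoisson

set_option linter.unusedSectionVars false

universe v u

open ComonObj

/-! ### Generalized elements parametrised by comonoids -/

section Elements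

variable {C : Type u} [Category.{v} C] [MonoidalCategory C] [SymmetricCategory C]

/-- The pairing of two generalized elements parametrised by a comonoid. -/
def pair {G X Y : C} [ComonObj G] (x : G ⟶ X) (y : G ⟶ Y) : G ⟶ X ⊗ Y := Δ[G] ≫ (x ⊗ₘ y)

section Pair

variable {G X Y Z W : C} [ComonObj G]

@[simp]
theorem pair_tensorHom (x : G ⟶ X) (y : G ⟶ Y) (f : X ⟶ Z) (g : Y ⟶ W) :
    pair x y ≫ (f ⊗ₘ g) = pair (x ≫ f) (y ≫ g) := by
  simp [pair]

@[simp]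
theorem pair_tensorHom_assoc (x : G ⟶ X) (y : G ⟶ Y) (f : X ⟶ Z) (g : Y ⟶ W) {T : C}
    (h : Z ⊗ W ⟶ T) :
    pair x y ≫ (f ⊗ₘ g) ≫ h = pair (x ≫ f) (y ≫ g) ≫ h := by
  rw [← Category.assoc, pair_tensorHom]

@[simp]
theorem pair_whiskerLeft (x : G ⟶ X) (y : G ⟶ Y) (g : Y ⟶ W) :
    pair x y ≫ X ◁ g = pair x (y ≫ g) := by
  simp [pair, ← id_tensorHom]

@[simp]
theorem pair_whiskerLeft_assoc (x : G ⟶ X) (y : G ⟶ Y) (g : Y ⟶ W) {T : C} (h : X ⊗ W ⟶ T) :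
    pair x y ≫ X ◁ g ≫ h = pair x (y ≫ g) ≫ h := by
  rw [← Category.assoc, pair_whiskerLeft]

@[simp]
theorem pair_whiskerRight (x : G ⟶ X) (y : G ⟶ Y) (f : X ⟶ Z) :
    pair x y ≫ f ▷ Y = pair (x ≫ f) y := by
  simp [pair, ← tensorHom_id]

@[simp]
theorem pair_whiskerRight_assoc (x : G ⟶ X) (y : G ⟶ Y) (f : X ⟶ Z) {T : C} (h : Z ⊗ Y ⟶ T) :
    pair x y ≫ f ▷ Y ≫ h = pair (x ≫ f) y ≫ h := by
  rw [← Category.assoc, pair_whiskerRight]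

@[simp]
theorem pair_associator_hom (x : G ⟶ X) (y : G ⟶ Y) (z : G ⟶ Z) :
    pair (pair x y) z ≫ (α_ X Y Z).hom = pair x (pair y z) := by
  have h : Δ[G] ≫ (Δ[G] ≫ (x ⊗ₘ y) ⊗ₘ z) =
      Δ[G] ≫ Δ[G] ▷ G ≫ ((x ⊗ₘ y) ⊗ₘ z) := by
        simp [MonoidalCategory.tensorHom_def, -associator_conjugation]
  have h' : Δ[G] ≫ (x ⊗ₘ Δ[G] ≫ (y ⊗ₘ z)) =
      Δ[G] ≫ G ◁ Δ[G] ≫ (x ⊗ₘ (y ⊗ₘ z)) := by simp [MonoidalCategory.tensorHom_def']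
  simp only [pair, h, h', Category.assoc, associator_naturality, comul_assoc_assoc]

@[simp]
theorem pair_associator_hom_assoc (x : G ⟶ X) (y : G ⟶ Y) (z : G ⟶ Z) {T : C}
    (h : X ⊗ (Y ⊗ Z) ⟶ T) :
    pair (pair x y) z ≫ (α_ X Y Z).hom ≫ h = pair x (pair y z) ≫ h := by
  rw [← Category.assoc, pair_associator_hom]

@[simp]
theorem pair_associator_inv (x : G ⟶ X) (y : G ⟶ Y) (z : G ⟶ Z) :
    pair x (pair y z) ≫ (α_ X Y Z).inv = pair (pair x y) z := by
  rw [← pair_associator_hom, Category.assoc, Iso.hom_inv_id, Category.comp_id]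

@[simp]
theorem pair_associator_inv_assoc (x : G ⟶ X) (y : G ⟶ Y) (z : G ⟶ Z) {T : C}
    (h : (X ⊗ Y) ⊗ Z ⟶ T) :
    pair x (pair y z) ≫ (α_ X Y Z).inv ≫ h = pair (pair x y) z ≫ h := by
  rw [← Category.assoc, pair_associator_inv]

@[simp]
theorem pair_braiding [IsCommComonObj G] (x : G ⟶ X) (y : G ⟶ Y) :
    pair x y ≫ (β_ X Y).hom = pair y x := by
  simp [pair]

@[simp]
theorem pair_braiding_assoc [IsCommComonObj G] (x : G ⟶ X) (y : G ⟶ Y) {T : C} (h : Y ⊗ X ⟶ T) :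
    pair x y ≫ (β_ X Y).hom ≫ h = pair y x ≫ h := by
  rw [← Category.assoc, pair_braiding]

@[simp]
theorem pair_counit_leftUnitor (x : G ⟶ X) : pair ε[G] x ≫ (λ_ X).hom = x := by
  simp [pair]

@[simp]
theorem pair_counit_rightUnitor (x : G ⟶ X) : pair x ε[G] ≫ (ρ_ X).hom = x := by
  simp [pair]

theorem comp_leftUnitor_inv (x : G ⟶ X) : x ≫ (λ_ X).inv = pair ε[G] x := by
  simp [pair, counit_comul_hom]

theorem comp_leftUnitor_inv_assoc (x : G ⟶ X) {T : C} (h : 𝟙_ C ⊗ X ⟶ T) :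
    x ≫ (λ_ X).inv ≫ h = pair ε[G] x ≫ h := by
  rw [← Category.assoc, comp_leftUnitor_inv]

theorem comp_rightUnitor_inv (x : G ⟶ X) : x ≫ (ρ_ X).inv = pair x ε[G] := by
  simp [pair, comul_counit_hom]

theorem comp_rightUnitor_inv_assoc (x : G ⟶ X) {T : C} (h : X ⊗ 𝟙_ C ⟶ T) :
    x ≫ (ρ_ X).inv ≫ h = pair x ε[G] ≫ h := by
  rw [← Category.assoc, comp_rightUnitor_inv]

theorem comp_pair {H : C} [ComonObj H] (p : H ⟶ G) [IsComonHom p] (x : G ⟶ X) (y : G ⟶ Y) :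
    p ≫ pair x y = pair (p ≫ x) (p ≫ y) := by
  simp [pair, IsComonHom.hom_comul_assoc]

theorem comp_pair_assoc {H : C} [ComonObj H] (p : H ⟶ G) [IsComonHom p] (x : G ⟶ X) (y : G ⟶ Y)
    {T : C} (h : X ⊗ Y ⟶ T) :
    p ≫ pair x y ≫ h = pair (p ≫ x) (p ≫ y) ≫ h := by
  rw [← Category.assoc, comp_pair]

end Pair

section Additive

variable [Preadditive C] [MonoidalPreadditive C] {G X Y : C} [ComonObj G]

theorem pair_add (x : G ⟶ X) (y y' : G ⟶ Y) : pair x (y + y') = pair x y + pair x y' := by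
  simp [pair, MonoidalPreadditive.tensor_add]

theorem add_pair (x x' : G ⟶ X) (y : G ⟶ Y) : pair (x + x') y = pair x y + pair x' y := by
  simp [pair, MonoidalPreadditive.add_tensor]

@[simp]
theorem pair_zero (x : G ⟶ X) : pair x (0 : G ⟶ Y) = 0 := by simp [pair]

@[simp]
theorem zero_pair (y : G ⟶ Y) : pair (0 : G ⟶ X) y = 0 := by simp [pair]

theorem pair_neg (x : G ⟶ X) (y : G ⟶ Y) : pair x (-y) = -pair x y := by
  rw [eq_neg_iff_add_eq_zero, ← pair_add]; simp

theorem pair_zsmul (n : ℤ) (x : G ⟶ X) (y : G ⟶ Y) : pair x (n • y) = n • pair x y :=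
  (AddMonoidHom.mk' (fun y : G ⟶ Y => pair x y) (pair_add x)).map_zsmul n y

end Additive

/-! ### The convolution ring of elements of a commutative monoid -/

section Ring

variable [Preadditive C] [MonoidalPreadditive C]

/-- Convolution: generalized elements of a commutative monoid form a commutative ring. -/
instance homCommRing {G S : C} [ComonObj G] [IsCommComonObj G] [MonObj S] [IsCommMonObj S] :
    CommRing (G ⟶ S) :=
  { (inferInstance : AddCommGroup (G ⟶ S)) with
    mul := fun s t => pair s t ≫ μ[S]
    one := ε[G] ≫ η[S]
    mul_assoc := fun s t r => by
      change pair (pair s t ≫ μ[S]) r ≫ μ[S] = pair s (pair t r ≫ μ[S]) ≫ μ[S]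
      rw [← pair_whiskerRight_assoc, MonObj.mul_assoc]; simp
    one_mul := fun s => by
      change pair (ε[G] ≫ η[S]) s ≫ μ[S] = s
      rw [← pair_whiskerRight_assoc, MonObj.one_mul]; simp
    mul_one := fun s => by
      change pair s (ε[G] ≫ η[S]) ≫ μ[S] = s
      rw [← pair_whiskerLeft_assoc, MonObj.mul_one]; simp
    mul_comm := fun s t => by
      change pair s t ≫ μ[S] = pair t s ≫ μ[S]
      rw [← pair_braiding_assoc, IsCommMonObj.mul_comm]
    left_distrib := fun s t r => by
      change pair s (t + r) ≫ μ[S] = pair s t ≫ μ[S] + pair s r ≫ μ[S]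
      simp [pair_add]
    right_distrib := fun s t r => by
      change pair (s + t) r ≫ μ[S] = pair s r ≫ μ[S] + pair t r ≫ μ[S]
      simp [add_pair]
    zero_mul := fun s => by
      change pair 0 s ≫ μ[S] = 0
      simp
    mul_zero := fun s => by
      change pair s 0 ≫ μ[S] = 0
      simp }

variable {G S : C} [ComonObj G] [IsCommComonObj G] [MonObj S] [IsCommMonObj S]

@[simp]
theorem pair_mul (s t : G ⟶ S) : pair s t ≫ μ[S] = s * t := rfl

@[simp]
theorem counit_one : ε[G] ≫ η[S] = (1 : G ⟶ S) := rfl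

theorem comp_mul {H : C} [ComonObj H] [IsCommComonObj H] (p : H ⟶ G) [IsComonHom p]
    (s t : G ⟶ S) : p ≫ (s * t) = (p ≫ s) * (p ≫ t) := by
  rw [← pair_mul, ← pair_mul, ← Category.assoc, comp_pair]

end Ring

/-! ### The square-zero comonoid carrying a generic element -/

section Square

variable [Preadditive C] [MonoidalPreadditive C] [HasBinaryBiproducts C]

/-- The square-zero comonoid `1 ⊞ X`. -/
def Gen (X : C) : C := 𝟙_ C ⊞ X

namespace Gen

variable (X : C)

/-- The generic element of `X`. -/
def elt : Gen X ⟶ X := biprod.snd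

/-- The inclusion of `X` in `1 ⊞ X`. -/
def inc : X ⟶ Gen X := biprod.inr

/-- The inclusion of the unit in `1 ⊞ X`. -/
def pt : 𝟙_ C ⟶ Gen X := biprod.inl

variable {X} in
theorem hom_ext {M : C} {f g : Gen X ⟶ M} (h₁ : pt X ≫ f = pt X ≫ g)
    (h₂ : inc X ≫ f = inc X ≫ g) : f = g := biprod.hom_ext' _ _ h₁ h₂

@[simp] theorem inc_elt : inc X ≫ elt X = 𝟙 X := biprod.inr_snd

/-- The comultiplication of `1 ⊞ X`, for which `X` is primitive. -/
def comul : Gen X ⟶ Gen X ⊗ Gen X :=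
  biprod.desc ((λ_ (𝟙_ C)).inv ≫ (pt X ⊗ₘ pt X))
    ((λ_ X).inv ≫ (pt X ⊗ₘ inc X) + (ρ_ X).inv ≫ (inc X ⊗ₘ pt X))

/-- The counit of `1 ⊞ X`. -/
def counit : Gen X ⟶ 𝟙_ C := biprod.fst

@[simp] theorem pt_counit : pt X ≫ counit X = 𝟙 _ := biprod.inl_fst

@[simp] theorem inc_counit : inc X ≫ counit X = 0 := biprod.inr_fst

@[simp] theorem pt_comul :
    pt X ≫ comul X = (λ_ (𝟙_ C)).inv ≫ (pt X ⊗ₘ pt X) := biprod.inl_desc _ _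

@[simp]
theorem pt_comul_assoc {T : C} (h : Gen X ⊗ Gen X ⟶ T) :
    pt X ≫ comul X ≫ h = ((λ_ (𝟙_ C)).inv ≫ (pt X ⊗ₘ pt X)) ≫ h := by
  rw [← Category.assoc, pt_comul]

@[simp] theorem inc_comul :
    inc X ≫ comul X =
      (λ_ X).inv ≫ (pt X ⊗ₘ inc X) + (ρ_ X).inv ≫ (inc X ⊗ₘ pt X) := biprod.inr_desc _ _

@[simp]
theorem inc_comul_assoc {T : C} (h : Gen X ⊗ Gen X ⟶ T) :
    inc X ≫ comul X ≫ h =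
      ((λ_ X).inv ≫ (pt X ⊗ₘ inc X) + (ρ_ X).inv ≫ (inc X ⊗ₘ pt X)) ≫ h := by
  rw [← Category.assoc, inc_comul]

instance : ComonObj (Gen X) where
  counit := counit X
  comul := comul X
  counit_comul := by
    apply hom_ext <;> simp [← tensorHom_id, Preadditive.add_comp]
  comul_counit := by
    apply hom_ext
    · simp [← id_tensorHom, unitors_inv_equal]
    · simp [← id_tensorHom, Preadditive.add_comp]
  comul_assoc := by
    apply hom_ext
    · simp only [pt_comul_assoc, Category.assoc, ← id_tensorHom, ← tensorHom_id,
        tensorHom_comp_tensorHom_assoc, tensorHom_comp_tensorHom, Category.comp_id, pt_comul]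
      monoidal
    · simp only [inc_comul_assoc, Category.assoc, ← id_tensorHom, ← tensorHom_id,
        tensorHom_comp_tensorHom_assoc, tensorHom_comp_tensorHom, Category.comp_id, pt_comul,
        inc_comul, Preadditive.add_comp, MonoidalPreadditive.tensor_add,
        MonoidalPreadditive.add_tensor, Preadditive.comp_add, add_assoc]
      congr 1
      · monoidal
      · congr 1 <;> monoidal

instance : IsCommComonObj (Gen X) where
  comul_comm := by
    apply hom_ext
    · change pt X ≫ comul X ≫ _ = pt X ≫ comul X
      simp [unitors_inv_equal]
    · change inc X ≫ comul X ≫ _ = inc X ≫ comul X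
      simp [Preadditive.add_comp, add_comm]

end Gen
end Square

/-! ### Tensor products of comonoids as contexts with independent variables -/

section Projections

variable (G H : C) [ComonObj G] [ComonObj H]

/-- The first projection of a tensor product of comonoids. -/
def fst : G ⊗ H ⟶ G := G ◁ ε[H] ≫ (ρ_ G).hom

/-- The second projection of a tensor product of comonoids. -/
def snd : G ⊗ H ⟶ H := ε[G] ▷ H ≫ (λ_ H).hom

instance : IsComonHom (fst G H) := by
  let f : Comon.mk G ⊗ Comon.mk H ⟶ Comon.mk G :=
    Comon.mk G ◁ (default : Comon.mk H ⟶ Comon.trivial C) ≫ (ρ_ (Comon.mk G)).hom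
  have h : f.hom = fst G H := by
    change (Comon.mk G ◁ (default : Comon.mk H ⟶ Comon.trivial C)).hom ≫
      (ρ_ (Comon.mk G)).hom.hom = _
    rw [Comon.monoidal_whiskerLeft_hom, Comon.monoidal_rightUnitor_hom_hom]
    change G ◁ ε[H] ≫ G ◁ 𝟙 (𝟙_ C) ≫ (ρ_ G).hom = _
    simp [fst]
  rw [← h]
  exact f.isComonHom_hom

instance : IsComonHom (snd G H) := by
  let f : Comon.mk G ⊗ Comon.mk H ⟶ Comon.mk H :=
    (default : Comon.mk G ⟶ Comon.trivial C) ▷ Comon.mk H ≫ (λ_ (Comon.mk H)).hom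
  have h : f.hom = snd G H := by
    change ((default : Comon.mk G ⟶ Comon.trivial C) ▷ Comon.mk H).hom ≫
      (λ_ (Comon.mk H)).hom.hom = _
    rw [Comon.monoidal_whiskerRight_hom, Comon.monoidal_leftUnitor_hom_hom]
    change ε[G] ▷ H ≫ 𝟙 (𝟙_ C) ▷ H ≫ (λ_ H).hom = _
    simp [snd]
  rw [← h]
  exact f.isComonHom_hom

/-- With this, elements over `G` and over `H` can be pulled back to the common parameter `G ⊗ H` and
paired there, and nothing is lost: the pair is the external tensor product. -/
theorem pair_fst_snd : pair (fst G H) (snd G H) = 𝟙 (G ⊗ H) := by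
  have h : (fst G H ⊗ₘ snd G H) =
      ((𝟙 G ⊗ₘ ε[H]) ⊗ₘ (ε[G] ⊗ₘ 𝟙 H)) ≫ ((ρ_ G).hom ⊗ₘ (λ_ H).hom) := by
    simp [fst, snd]
  rw [pair, h, Comon.tensorObj_comul, Category.assoc, ← tensorμ_natural_assoc]
  have hβ : (β_ (𝟙_ C) (𝟙_ C)).hom = 𝟙 _ := by simp [unitors_inv_equal]
  simp only [tensorHom_comp_tensorHom_assoc, id_tensorHom, tensorHom_id, comul_counit,
    counit_comul, tensorμ, hβ]
  monoidal

variable {G H}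

theorem pair_fst_comp_snd_comp {X Y : C} (x : G ⟶ X) (y : H ⟶ Y) :
    pair (fst G H ≫ x) (snd G H ≫ y) = x ⊗ₘ y := by
  rw [← pair_tensorHom, pair_fst_snd, Category.id_comp]

end Projections

/-! ### Equality of maps tested on generalized elements -/

section Ext

variable [Preadditive C] [MonoidalPreadditive C] [HasBinaryBiproducts C]

instance (X : C) : IsSplitEpi (Gen.elt X) := ⟨⟨⟨Gen.inc X, Gen.inc_elt X⟩⟩⟩

instance {X Y X' Y' : C} (f : X ⟶ X') (g : Y ⟶ Y') [IsSplitEpi f] [IsSplitEpi g] :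
    IsSplitEpi (f ⊗ₘ g) :=
  ⟨⟨⟨section_ f ⊗ₘ section_ g, by simp⟩⟩⟩

variable {X Y Z W M : C}

/-- The generic element `Gen.elt X` is itself a test element and is a split epimorphism. The
variants below use tensor products of generic elements in the same way. -/
theorem elt_ext {f g : X ⟶ M}
    (h : ∀ (G : C) [ComonObj G] [IsCommComonObj G] (x : G ⟶ X), x ≫ f = x ≫ g) : f = g :=
  (cancel_epi (Gen.elt X)).1 (h _ _)

theorem pair_ext {f g : X ⊗ Y ⟶ M}
    (h : ∀ (G : C) [ComonObj G] [IsCommComonObj G] (x : G ⟶ X) (y : G ⟶ Y),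
      pair x y ≫ f = pair x y ≫ g) : f = g := by
  have := h (Gen X ⊗ Gen Y) (fst _ _ ≫ Gen.elt X) (snd _ _ ≫ Gen.elt Y)
  rwa [pair_fst_comp_snd_comp, cancel_epi] at this

theorem pair_pair_ext {f g : (X ⊗ Y) ⊗ Z ⟶ M}
    (h : ∀ (G : C) [ComonObj G] [IsCommComonObj G] (x : G ⟶ X) (y : G ⟶ Y) (z : G ⟶ Z),
      pair (pair x y) z ≫ f = pair (pair x y) z ≫ g) : f = g := by
  have := h ((Gen X ⊗ Gen Y) ⊗ Gen Z) (fst _ _ ≫ fst _ _ ≫ Gen.elt X)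
    (fst _ _ ≫ snd _ _ ≫ Gen.elt Y) (snd _ _ ≫ Gen.elt Z)
  rwa [← comp_pair, pair_fst_comp_snd_comp, pair_fst_comp_snd_comp, cancel_epi] at this

theorem pair_pair_ext' {f g : X ⊗ (Y ⊗ Z) ⟶ M}
    (h : ∀ (G : C) [ComonObj G] [IsCommComonObj G] (x : G ⟶ X) (y : G ⟶ Y) (z : G ⟶ Z),
      pair x (pair y z) ≫ f = pair x (pair y z) ≫ g) : f = g := by
  rw [← cancel_epi (α_ X Y Z).hom]
  exact pair_pair_ext fun G _ _ x y z => by simpa using h G x y z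

theorem pair_pair_pair_ext {f g : (X ⊗ Y) ⊗ (Z ⊗ W) ⟶ M}
    (h : ∀ (G : C) [ComonObj G] [IsCommComonObj G] (x : G ⟶ X) (y : G ⟶ Y) (z : G ⟶ Z)
      (w : G ⟶ W), pair (pair x y) (pair z w) ≫ f = pair (pair x y) (pair z w) ≫ g) :
    f = g := by
  have := h ((Gen X ⊗ Gen Y) ⊗ (Gen Z ⊗ Gen W)) (fst _ _ ≫ fst _ _ ≫ Gen.elt X)
    (fst _ _ ≫ snd _ _ ≫ Gen.elt Y) (snd _ _ ≫ fst _ _ ≫ Gen.elt Z)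
    (snd _ _ ≫ snd _ _ ≫ Gen.elt W)
  simp only [← comp_pair, pair_fst_comp_snd_comp] at this
  rwa [cancel_epi] at this

theorem pair_pair_pair_pair_pair_ext {X' Y' : C} {f g : (X ⊗ Y) ⊗ ((Z ⊗ W) ⊗ (X' ⊗ Y')) ⟶ M}
    (h : ∀ (G : C) [ComonObj G] [IsCommComonObj G] (x : G ⟶ X) (y : G ⟶ Y) (z : G ⟶ Z)
      (w : G ⟶ W) (x' : G ⟶ X') (y' : G ⟶ Y'),
      pair (pair x y) (pair (pair z w) (pair x' y')) ≫ f =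
        pair (pair x y) (pair (pair z w) (pair x' y')) ≫ g) : f = g := by
  have := h ((Gen X ⊗ Gen Y) ⊗ ((Gen Z ⊗ Gen W) ⊗ (Gen X' ⊗ Gen Y')))
    (fst _ _ ≫ fst _ _ ≫ Gen.elt X) (fst _ _ ≫ snd _ _ ≫ Gen.elt Y)
    (snd _ _ ≫ fst _ _ ≫ fst _ _ ≫ Gen.elt Z) (snd _ _ ≫ fst _ _ ≫ snd _ _ ≫ Gen.elt W)
    (snd _ _ ≫ snd _ _ ≫ fst _ _ ≫ Gen.elt X') (snd _ _ ≫ snd _ _ ≫ snd _ _ ≫ Gen.elt Y')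
  simp only [← comp_pair, pair_fst_comp_snd_comp] at this
  rwa [cancel_epi] at this

end Ext

end Elements

/-! ### Tensor words and the moves between them -/

/-- Formal tensor words in one letter. -/
inductive Word : Type
  | letter : Word
  | unit : Word
  | mul : Word → Word → Word

namespace Word

variable {C : Type u} [Category.{v} C] [MonoidalCategory C] [SymmetricCategory C]

/-- The tensor power of `x` described by a word. -/
def obj (x : C) : Word → C
  | letter => x
  | unit => 𝟙_ C
  | mul a b => obj x a ⊗ obj x b

/-- The structural morphisms between tensor powers which become identities in the free commutative
monoid. -/
inductive Move (x : C) : ∀ a b : Word, (a.obj x ⟶ b.obj x) → Prop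
  | assoc (a b c : Word) :
      Move x ((a.mul b).mul c) (a.mul (b.mul c)) (α_ (a.obj x) (b.obj x) (c.obj x)).hom
  | unit_mul (a : Word) : Move x (unit.mul a) a (λ_ (a.obj x)).hom
  | braid (a b : Word) : Move x (a.mul b) (b.mul a) (β_ (a.obj x) (b.obj x)).hom
  | whiskerLeft (a : Word) {b c : Word} {s : b.obj x ⟶ c.obj x} (hs : Move x b c s) :
      Move x (a.mul b) (a.mul c) (a.obj x ◁ s)

/-- Evaluation of a word in a monoid. -/
def ev {x A : C} [MonObj A] (f : x ⟶ A) : ∀ w : Word, w.obj x ⟶ A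
  | letter => f
  | unit => η[A]
  | mul a b => (ev f a ⊗ₘ ev f b) ≫ μ[A]

/-- A family of maps out of the words which factors through the free commutative monoid. -/
def Compatible {x Z M : C} (f : ∀ w : Word, Z ⊗ w.obj x ⟶ M) : Prop :=
  ∀ (a b : Word) (s : a.obj x ⟶ b.obj x), Move x a b s → Z ◁ s ≫ f b = f a

theorem ev_move [Preadditive C] [MonoidalPreadditive C] [HasBinaryBiproducts C]
    {x A : C} [MonObj A] [IsCommMonObj A] (f : x ⟶ A) {a b : Word}
    {s : a.obj x ⟶ b.obj x} (hs : Move x a b s) : s ≫ ev f b = ev f a := by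
  induction hs with
  | assoc a b c =>
    change (α_ _ _ _).hom ≫ (ev f a ⊗ₘ ((ev f b ⊗ₘ ev f c) ≫ μ[A])) ≫ μ[A] =
      (((ev f a ⊗ₘ ev f b) ≫ μ[A]) ⊗ₘ ev f c) ≫ μ[A]
    exact pair_pair_ext fun G _ _ x y z => by simp [_root_.mul_assoc]
  | unit_mul a =>
    change (λ_ _).hom ≫ ev f a = (η[A] ⊗ₘ ev f a) ≫ μ[A]
    rw [MonoidalCategory.tensorHom_def', Category.assoc, MonObj.one_mul, leftUnitor_naturality]
  | braid a b =>
    change (β_ _ _).hom ≫ (ev f b ⊗ₘ ev f a) ≫ μ[A] = (ev f a ⊗ₘ ev f b) ≫ μ[A]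
    exact pair_ext fun G _ _ x y => by simp [_root_.mul_comm]
  | @whiskerLeft a b c s hs ih =>
    change a.obj x ◁ s ≫ (ev f a ⊗ₘ ev f c) ≫ μ[A] = (ev f a ⊗ₘ ev f b) ≫ μ[A]
    rw [← id_tensorHom, tensorHom_comp_tensorHom_assoc, ih, Category.id_comp]

theorem ev_comp {x A B : C} [MonObj A] [MonObj B] (f : x ⟶ A) (g : A ⟶ B) [IsMonHom g] (w : Word) :
    ev f w ≫ g = ev (f ≫ g) w := by
  induction w with
  | letter => rfl
  | unit => exact IsMonHom.one_hom g
  | mul a b iha ihb =>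
    change ((ev f a ⊗ₘ ev f b) ≫ μ[A]) ≫ g = (ev (f ≫ g) a ⊗ₘ ev (f ≫ g) b) ≫ μ[B]
    simp [IsMonHom.mul_hom, ← iha, ← ihb]

end Word

/-! ### The free commutative monoid as a colimit of words -/

section Free

open Word

variable {C : Type u} [Category.{v} C] [MonoidalCategory C] [SymmetricCategory C] [HasColimits C]

variable (x : C)

/-- The diagram of all words and structural morphisms. -/
def wordIndex : MultispanIndex
    { L := Σ a b : ULift.{v} Word, { s : a.down.obj x ⟶ b.down.obj x // Move x a.down b.down s }
      R := ULift.{v} Word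
      fst := fun p => p.1
      snd := fun p => p.2.1 } C where
  left p := p.1.down.obj x
  right w := w.down.obj x
  fst _ := 𝟙 _
  snd p := p.2.2.1

/-- The underlying object of the free commutative monoid. -/
def FreeComm : C := multicoequalizer (wordIndex x)

namespace FreeComm

/-- The map from a tensor power to the free commutative monoid. -/
def incl (w : Word) : w.obj x ⟶ FreeComm x := Multicoequalizer.π (wordIndex x) ⟨w⟩

variable {x}

theorem move_incl {a b : Word} {s : a.obj x ⟶ b.obj x} (hs : Move x a b s) :
    s ≫ incl x b = incl x a := by
  have := Multicoequalizer.condition (wordIndex x) ⟨⟨a⟩, ⟨b⟩, s, hs⟩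
  exact this.symm.trans (Category.id_comp _)

variable [∀ X : C, PreservesColimits (tensorLeft X)] {Z M : C}

theorem hom_ext {f g : Z ⊗ FreeComm x ⟶ M}
    (h : ∀ w, Z ◁ incl x w ≫ f = Z ◁ incl x w ≫ g) : f = g := by
  have hc := isColimitOfPreserves (tensorLeft Z) (colimit.isColimit (wordIndex x).multispan)
  refine hc.hom_ext ?_
  rintro (p | w)
  · have e : colimit.ι (wordIndex x).multispan (.left p) = incl x p.1.down :=
      (colimit.w (wordIndex x).multispan (WalkingMultispan.Hom.fst p)).symm.trans
        (Category.id_comp _)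
    change Z ◁ colimit.ι (wordIndex x).multispan (.left p) ≫ f =
      Z ◁ colimit.ι (wordIndex x).multispan (.left p) ≫ g
    rw [e]
    exact h p.1.down
  · exact h w.down

theorem exists_desc {f : ∀ w : Word, Z ⊗ w.obj x ⟶ M} (hf : Compatible f) :
    ∃ g : Z ⊗ FreeComm x ⟶ M, ∀ w, Z ◁ incl x w ≫ g = f w := by
  let c : Cocone ((wordIndex x).multispan ⋙ tensorLeft Z) := Cocone.mk M
    { app := fun j => match j with
        | .left p => f p.1.down
        | .right w => f w.down
      naturality := by
        rintro _ _ (_ | p | p)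
        · simp
        · change Z ◁ 𝟙 _ ≫ f p.1.down = f p.1.down ≫ 𝟙 _
          simp
        · change Z ◁ p.2.2.1 ≫ f p.2.1.down = f p.1.down ≫ 𝟙 _
          rw [hf _ _ _ p.2.2.2, Category.comp_id] }
  exact ⟨(isColimitOfPreserves (tensorLeft Z) (colimit.isColimit (wordIndex x).multispan)).desc c,
    fun w => (isColimitOfPreserves (tensorLeft Z)
      (colimit.isColimit (wordIndex x).multispan)).fac c (.right ⟨w⟩)⟩

/-- Whiskering on the right is whiskering on the left conjugated by the symmetry, which is why
`Move` needs only the left version. -/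
theorem whiskerRight_incl_mul (u : Word) {a b : Word} {s : a.obj x ⟶ b.obj x}
    (hs : Move x a b s) : s ▷ u.obj x ≫ incl x (b.mul u) = incl x (a.mul u) := by
  have h₁ : (β_ (u.obj x) (b.obj x)).hom ≫ incl x (b.mul u) = incl x (u.mul b) :=
    move_incl (.braid u b)
  have h₂ : (β_ (a.obj x) (u.obj x)).hom ≫ incl x (u.mul a) = incl x (a.mul u) :=
    move_incl (.braid a u)
  have h₃ : u.obj x ◁ s ≫ incl x (u.mul b) = incl x (u.mul a) := move_incl (.whiskerLeft u hs)
  rw [← h₂, ← h₃, ← h₁, ← BraidedCategory.braiding_naturality_left_assoc]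
  congr 1
  exact (SymmetricCategory.symmetry_assoc _ _ _).symm

theorem exists_mul_word (w : Word) : ∃ g : w.obj x ⊗ FreeComm x ⟶ FreeComm x,
    ∀ u : Word, w.obj x ◁ incl x u ≫ g = incl x (w.mul u) :=
  exists_desc fun _ _ _ hs => move_incl (.whiskerLeft w hs)

theorem exists_mul : ∃ g : FreeComm x ⊗ FreeComm x ⟶ FreeComm x,
    ∀ a b : Word, (incl x a ⊗ₘ incl x b) ≫ g = incl x (a.mul b) := by
  choose m hm using exists_mul_word (x := x)
  have hc : Compatible fun w => (β_ (FreeComm x) (w.obj x)).hom ≫ m w := by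
    intro a b s hs
    rw [BraidedCategory.braiding_naturality_right_assoc]
    congr 1
    refine hom_ext fun w => ?_
    rw [whisker_exchange_assoc, hm, hm, whiskerRight_incl_mul w hs]
  obtain ⟨g, hg⟩ := exists_desc hc
  refine ⟨g, fun a b => ?_⟩
  have h : (β_ (a.obj x) (b.obj x)).hom ≫ incl x (b.mul a) = incl x (a.mul b) :=
    move_incl (.braid a b)
  rw [MonoidalCategory.tensorHom_def, Category.assoc, hg b,
    BraidedCategory.braiding_naturality_left_assoc, hm, h]

/-- The multiplication of the free commutative monoid, given by concatenation of words. -/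
def mul (x : C) : FreeComm x ⊗ FreeComm x ⟶ FreeComm x := exists_mul.choose

theorem incl_mul (a b : Word) : (incl x a ⊗ₘ incl x b) ≫ mul x = incl x (a.mul b) :=
  exists_mul.choose_spec a b

theorem hom_ext_left {f g : FreeComm x ⊗ Z ⟶ M} (h : ∀ w, incl x w ▷ Z ≫ f = incl x w ▷ Z ≫ g) :
    f = g := by
  rw [← cancel_epi (β_ Z (FreeComm x)).hom]
  refine hom_ext fun w => ?_
  simp [h]

theorem hom_ext_pair {f g : FreeComm x ⊗ FreeComm x ⟶ M}
    (h : ∀ a b, (incl x a ⊗ₘ incl x b) ≫ f = (incl x a ⊗ₘ incl x b) ≫ g) : f = g :=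
  hom_ext_left fun a => hom_ext fun b => by
    simpa [MonoidalCategory.tensorHom_def'] using h a b

theorem hom_ext_single {f g : FreeComm x ⟶ M} (h : ∀ w, incl x w ≫ f = incl x w ≫ g) : f = g := by
  rw [← cancel_epi (λ_ (FreeComm x)).hom]
  refine hom_ext fun w => ?_
  simp [h]

theorem hom_ext_triple {f g : (FreeComm x ⊗ FreeComm x) ⊗ FreeComm x ⟶ M}
    (h : ∀ a b c, ((incl x a ⊗ₘ incl x b) ⊗ₘ incl x c) ≫ f =
      ((incl x a ⊗ₘ incl x b) ⊗ₘ incl x c) ≫ g) : f = g := by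
  refine hom_ext fun c => ?_
  rw [← cancel_epi (α_ _ _ _).inv]
  refine hom_ext_left fun a => ?_
  rw [associator_inv_naturality_left_assoc, associator_inv_naturality_left_assoc, cancel_epi,
    ← cancel_epi ((β_ _ _).hom ▷ _), ← cancel_epi (α_ _ _ _).inv]
  refine hom_ext_left fun b => ?_
  have e : incl x b ▷ a.obj x ▷ c.obj x ≫ (β_ (FreeComm x) (a.obj x)).hom ▷ c.obj x =
      (β_ (b.obj x) (a.obj x)).hom ▷ c.obj x ≫ (a.obj x ◁ incl x b) ▷ c.obj x := by
    rw [← comp_whiskerRight, BraidedCategory.braiding_naturality_left, comp_whiskerRight]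
  rw [associator_inv_naturality_left_assoc, associator_inv_naturality_left_assoc, cancel_epi,
    reassoc_of% e, reassoc_of% e, cancel_epi]
  have := h a b c
  rwa [MonoidalCategory.tensorHom_def, MonoidalCategory.tensorHom_def', comp_whiskerRight,
    Category.assoc, Category.assoc, Category.assoc, Category.assoc] at this

/-- The unit of the free commutative monoid. -/
def one (x : C) : 𝟙_ C ⟶ FreeComm x := incl x .unit

theorem one_incl (w : Word) : (one x ⊗ₘ incl x w) ≫ mul x = (λ_ _).hom ≫ incl x w :=
  (incl_mul .unit w).trans (move_incl (.unit_mul w)).symm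

theorem braiding_mul : (β_ (FreeComm x) (FreeComm x)).hom ≫ mul x = mul x :=
  hom_ext_pair fun a b => by
    rw [BraidedCategory.braiding_naturality_assoc, incl_mul, incl_mul]
    exact move_incl (.braid a b)

theorem one_mul : one x ▷ FreeComm x ≫ mul x = (λ_ (FreeComm x)).hom :=
  hom_ext fun w => by
    rw [← MonoidalCategory.tensorHom_def'_assoc, one_incl, leftUnitor_naturality]

instance : MonObj (FreeComm x) where
  one := one x
  mul := mul x
  one_mul := one_mul
  mul_one := by
    rw [← braiding_mul, BraidedCategory.braiding_naturality_right_assoc, one_mul]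
    simp
  mul_assoc := hom_ext_triple fun a b c => by
    have h₁ : ((incl x a ⊗ₘ incl x b) ⊗ₘ incl x c) ≫ mul x ▷ FreeComm x ≫ mul x =
        (incl x (a.mul b) ⊗ₘ incl x c) ≫ mul x := by
      rw [tensorHom_comp_whiskerRight_assoc, incl_mul]; rfl
    have h₂ : (incl x a ⊗ₘ incl x b ⊗ₘ incl x c) ≫ FreeComm x ◁ mul x ≫ mul x =
        (incl x a ⊗ₘ incl x (b.mul c)) ≫ mul x := by
      rw [tensorHom_comp_whiskerLeft_assoc, incl_mul]; rfl
    rw [h₁, incl_mul, associator_naturality_assoc, h₂, incl_mul]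
    exact (move_incl (.assoc a b c)).symm

instance : IsCommMonObj (FreeComm x) where
  mul_comm := braiding_mul

variable (x) in
/-- The inclusion of generators. -/
def gen : x ⟶ FreeComm x := incl x .letter

theorem ev_gen (w : Word) : ev (gen x) w = incl x w := by
  induction w with
  | letter => rfl
  | unit => rfl
  | mul a b iha ihb =>
    change (ev (gen x) a ⊗ₘ ev (gen x) b) ≫ mul x = _
    rw [iha, ihb, incl_mul]

variable [Preadditive C] [MonoidalPreadditive C] [HasBinaryBiproducts C]

variable (x) in
theorem isFreeCommMon : IsFreeCommMon (gen x) := by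
  intro A _ _ f
  obtain ⟨g, hg⟩ := exists_desc (x := x) (Z := 𝟙_ C) (f := fun w => (λ_ _).hom ≫ ev f w)
    fun a b s hs => by rw [leftUnitor_naturality_assoc, ev_move f hs]
  have hg' : ∀ w, incl x w ≫ (λ_ _).inv ≫ g = ev f w := fun w => by
    rw [leftUnitor_inv_naturality_assoc, hg, Iso.inv_hom_id_assoc]
  refine ⟨(λ_ _).inv ≫ g, ⟨⟨hg' .unit, hom_ext_pair fun a b => ?_⟩, hg' .letter⟩, ?_⟩
  · change (_ ⊗ₘ _) ≫ mul x ≫ _ = _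
    rw [← Category.assoc, incl_mul, tensorHom_comp_tensorHom_assoc, hg', hg']
    exact hg' (a.mul b)
  · rintro g' ⟨_, h⟩
    refine hom_ext_single fun w => ?_
    rw [hg', ← ev_gen, ev_comp, h]

end FreeComm

namespace IsFreeCommMon

variable {x} {S : C} [MonObj S] [IsCommMonObj S] {inc : x ⟶ S}
variable [∀ X : C, PreservesColimits (tensorLeft X)]
variable [Preadditive C] [MonoidalPreadditive C] [HasBinaryBiproducts C]

/-- Carries the universal property of `FreeComm` for maps `Z ⊗ S ⟶ M` over to any free commutative
monoid; `IsFreeCommMon` by itself speaks only of monoid morphisms. -/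
theorem exists_iso (h : IsFreeCommMon inc) :
    ∃ e : FreeComm x ≅ S, ∀ w, FreeComm.incl x w ≫ e.hom = ev inc w := by
  obtain ⟨f, ⟨_, hf⟩, -⟩ := FreeComm.isFreeCommMon x S inc
  obtain ⟨g, ⟨_, hg⟩, -⟩ := h (FreeComm x) (FreeComm.gen x)
  refine ⟨⟨f, g, ?_, ?_⟩, fun w => ?_⟩
  · exact (FreeComm.isFreeCommMon x _ (FreeComm.gen x)).unique
      ⟨inferInstance, by rw [← Category.assoc, hf, hg]⟩ ⟨inferInstance, Category.comp_id _⟩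
  · exact (h _ inc).unique
      ⟨inferInstance, by rw [← Category.assoc, hg, hf]⟩ ⟨inferInstance, Category.comp_id _⟩
  · change _ ≫ f = _
    rw [← FreeComm.ev_gen, ev_comp, hf]

theorem hom_ext (h : IsFreeCommMon inc) {Z M : C} {f g : Z ⊗ S ⟶ M}
    (H : ∀ w, Z ◁ ev inc w ≫ f = Z ◁ ev inc w ≫ g) : f = g := by
  obtain ⟨e, he⟩ := h.exists_iso
  rw [← cancel_epi (Z ◁ e.hom)]
  refine FreeComm.hom_ext fun w => ?_
  simpa [← he] using H w

theorem exists_desc (h : IsFreeCommMon inc) {Z M : C} {f : ∀ w : Word, Z ⊗ w.obj x ⟶ M}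
    (hf : Compatible f) : ∃ g : Z ⊗ S ⟶ M, ∀ w, Z ◁ ev inc w ≫ g = f w := by
  obtain ⟨e, he⟩ := h.exists_iso
  obtain ⟨g, hg⟩ := FreeComm.exists_desc hf
  exact ⟨Z ◁ e.inv ≫ g, fun w => by simp [← he, hg]⟩

end IsFreeCommMon

end Free

/-! ### Derivations in one variable and their extension from generators -/

section Derivations

variable {C : Type u} [Category.{v} C] [MonoidalCategory C] [SymmetricCategory C]
  [Preadditive C] [MonoidalPreadditive C] [HasBinaryBiproducts C]
  {S : C} [MonObj S] [IsCommMonObj S] {x Z Z' A A' M : C}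

theorem pair_pair_pair_ext' {X Y Z W : C} {f g : (X ⊗ (Y ⊗ Z)) ⊗ W ⟶ M}
    (h : ∀ (G : C) [ComonObj G] [IsCommComonObj G] (x : G ⟶ X) (y : G ⟶ Y) (z : G ⟶ Z)
      (w : G ⟶ W), pair (pair x (pair y z)) w ≫ f = pair (pair x (pair y z)) w ≫ g) :
    f = g := by
  rw [← cancel_epi ((α_ X Y Z).hom ▷ W), ← cancel_epi (α_ (X ⊗ Y) Z W).inv]
  exact pair_pair_pair_ext fun G _ _ x y z w => by simpa using h G x y z w

theorem pair_pair_pair_ext'' {X Y Z W : C} {f g : X ⊗ ((Y ⊗ Z) ⊗ W) ⟶ M}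
    (h : ∀ (G : C) [ComonObj G] [IsCommComonObj G] (x : G ⟶ X) (y : G ⟶ Y) (z : G ⟶ Z)
      (w : G ⟶ W), pair x (pair (pair y z) w) ≫ f = pair x (pair (pair y z) w) ≫ g) :
    f = g := by
  rw [← cancel_epi (X ◁ (α_ Y Z W).inv), ← cancel_epi (α_ X Y (Z ⊗ W)).hom]
  exact pair_pair_pair_ext fun G _ _ x y z w => by simpa using h G x y z w

/-- The map `f : Z ⊗ S ⟶ S` is a derivation in its last variable. -/
def IsDer (D : Z ⊗ S ⟶ S) : Prop :=
  ∀ (G : C) [ComonObj G] [IsCommComonObj G] (z : G ⟶ Z) (s t : G ⟶ S),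
    pair z (s * t) ≫ D = s * (pair z t ≫ D) + t * (pair z s ≫ D)

namespace IsDer

variable {D D' : Z ⊗ S ⟶ S}

theorem add (h : IsDer D) (h' : IsDer D') : IsDer (D + D') := fun G _ _ z s t => by
  simp only [Preadditive.comp_add, h G z s t, h' G z s t]; ring

theorem sub (h : IsDer D) (h' : IsDer D') : IsDer (D - D') := fun G _ _ z s t => by
  simp only [Preadditive.comp_sub, h G z s t, h' G z s t]; ring

theorem precomp (h : IsDer D) (g : Z' ⟶ Z) : IsDer (g ▷ S ≫ D) := fun G _ _ z s t => by
  simp [h G (z ≫ g) s t]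

theorem pair_one (h : IsDer D) {G : C} [ComonObj G] [IsCommComonObj G] (z : G ⟶ Z) :
    pair z (1 : G ⟶ S) ≫ D = 0 := by
  have := h G z 1 1
  simpa using this

theorem unit (h : IsDer D) : Z ◁ η[S] ≫ D = 0 := by
  rw [← cancel_epi (ρ_ Z).inv]
  exact elt_ext fun G _ _ z => by simp [comp_rightUnitor_inv_assoc, h.pair_one]

/-- An element of `X ⊗ Y` need not be a pair, so the Leibniz rule on pairs is first turned into an
equation of morphisms and then evaluated at an arbitrary element. -/
theorem of_pair {X Y : C} {D : (X ⊗ Y) ⊗ S ⟶ S}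
    (h : ∀ (G : C) [ComonObj G] [IsCommComonObj G] (x : G ⟶ X) (y : G ⟶ Y) (s t : G ⟶ S),
      pair (pair x y) (s * t) ≫ D =
        s * (pair (pair x y) t ≫ D) + t * (pair (pair x y) s ≫ D)) : IsDer D := by
  have e : (X ⊗ Y) ◁ μ[S] ≫ D = (α_ _ _ _).inv ≫ D ▷ S ≫ μ[S] +
      (X ⊗ Y) ◁ (β_ S S).hom ≫ (α_ _ _ _).inv ≫ D ▷ S ≫ μ[S] :=
    pair_pair_pair_ext fun G _ _ x y s t => by
      simp only [pair_whiskerLeft_assoc, pair_mul, h, Preadditive.comp_add,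
        pair_associator_inv_assoc, pair_whiskerRight_assoc, pair_braiding]
      ring
  intro G _ _ z s t
  have := pair z (pair s t) ≫= e
  simp only [pair_whiskerLeft_assoc, pair_mul, Preadditive.comp_add,
    pair_associator_inv_assoc, pair_whiskerRight_assoc, pair_braiding] at this
  rw [this]
  ring

end IsDer

theorem pair_pair_opT {G : C} [ComonObj G] [IsCommComonObj G] (f : Z ⊗ S ⟶ S) (s t : G ⟶ S)
    (z : G ⟶ Z) : pair (pair s z) t ≫ opT f = pair z (s * t) ≫ f - s * (pair z t ≫ f) := by
  simp [opT, Preadditive.comp_sub]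

theorem isDer_iff (D : Z ⊗ S ⟶ S) : IsDer D ↔ HasOrderLE 1 D ∧ Z ◁ η[S] ≫ D = 0 := by
  constructor
  · refine fun h => ⟨?_, h.unit⟩
    change opT (opT D) = 0
    refine pair_pair_pair_ext' fun G _ _ s t z r => ?_
    simp only [pair_pair_opT, h G, comp_zero]
    ring
  · rintro ⟨h, h₁⟩ G _ _ z s t
    have h₂ : pair z (1 : G ⟶ S) ≫ D = 0 := by
      rw [← counit_one, ← pair_whiskerLeft_assoc, h₁, comp_zero]
    -- Inserting the unit in the last variable of `T² D = 0` leaves `D(z, st) - t D(z, s) - s D(z,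
    -- t)`, since the term with `D(z, 1)` is zero.
    have h₃ : pair (pair s (pair t z)) 1 ≫ opT (opT D) = 0 := by
      rw [show opT (opT D) = 0 from h, comp_zero]
    simp only [pair_pair_opT, h₂, _root_.mul_one] at h₃
    rw [_root_.mul_comm t s] at h₃
    linear_combination h₃

theorem isBiDerivation_iff (B : S ⊗ S ⟶ S) :
    IsBiDerivation B ↔ IsDer ((β_ S S).hom ≫ B) ∧ IsDer B := by
  rw [isDer_iff, isDer_iff]
  have h : S ◁ η[S] ≫ (β_ S S).hom ≫ B = 0 ↔ η[S] ▷ S ≫ B = 0 := by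
    rw [BraidedCategory.braiding_naturality_right_assoc, Preadditive.IsIso.comp_left_eq_zero]
  rw [h]
  exact ⟨fun h => ⟨⟨h.order_fst, h.unit_fst⟩, ⟨h.order_snd, h.unit_snd⟩⟩,
    fun h => ⟨⟨h.1.1, h.2.1⟩, h.1.2, h.2.2⟩⟩

section Extend

open Word

/-- The Leibniz rule for a product of two factors. -/
def leibniz (D : Z ⊗ A ⟶ S) (f : A ⟶ S) (D' : Z ⊗ A' ⟶ S) (f' : A' ⟶ S) : Z ⊗ (A ⊗ A') ⟶ S :=
  (α_ _ _ _).inv ≫ (D ⊗ₘ f') ≫ μ[S] + Z ◁ (β_ A A').hom ≫ (α_ _ _ _).inv ≫ (D' ⊗ₘ f) ≫ μ[S]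

theorem pair_pair_leibniz {G : C} [ComonObj G] [IsCommComonObj G]
    (D : Z ⊗ A ⟶ S) (f : A ⟶ S) (D' : Z ⊗ A' ⟶ S) (f' : A' ⟶ S) (z : G ⟶ Z) (a : G ⟶ A)
    (a' : G ⟶ A') : pair z (pair a a') ≫ leibniz D f D' f' =
      (pair z a ≫ D) * (a' ≫ f') + (pair z a' ≫ D') * (a ≫ f) := by
  simp [leibniz, Preadditive.comp_add]

/-- The value on words of the derivation extending a map given on generators. -/
def derWord (inc : x ⟶ S) (φ : Z ⊗ x ⟶ S) : ∀ w : Word, Z ⊗ w.obj x ⟶ S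
  | letter => φ
  | unit => 0
  | .mul a b => leibniz (derWord inc φ a) (ev inc a) (derWord inc φ b) (ev inc b)

/-- Each move becomes an identity in the convolution ring: the Leibniz expression is insensitive to
regrouping, reordering and insertion of units because the ring is commutative and associative. -/
theorem compatible_derWord (inc : x ⟶ S) (φ : Z ⊗ x ⟶ S) : Compatible (derWord inc φ) := by
  intro a b s hs
  induction hs with
  | assoc a b c =>
    change Z ◁ (α_ _ _ _).hom ≫
        leibniz _ _ (leibniz (derWord inc φ b) _ (derWord inc φ c) _)
          ((ev inc b ⊗ₘ ev inc c) ≫ μ[S]) =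
      leibniz (leibniz (derWord inc φ a) _ (derWord inc φ b) _)
        ((ev inc a ⊗ₘ ev inc b) ≫ μ[S]) _ _
    refine pair_pair_pair_ext'' fun G _ _ z p q r => ?_
    simp only [pair_whiskerLeft_assoc, pair_associator_hom, pair_pair_leibniz,
      pair_tensorHom_assoc, pair_mul]
    ring
  | unit_mul a =>
    change Z ◁ (λ_ _).hom ≫ derWord inc φ a = leibniz 0 η[S] (derWord inc φ a) (ev inc a)
    rw [← cancel_epi (Z ◁ (λ_ _).inv)]
    refine pair_ext fun G _ _ z p => ?_
    simp [comp_leftUnitor_inv, pair_pair_leibniz]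
  | braid a b =>
    change Z ◁ (β_ _ _).hom ≫ leibniz _ _ _ _ = leibniz _ _ _ _
    refine pair_pair_ext' fun G _ _ z p q => ?_
    simp only [pair_whiskerLeft_assoc, pair_braiding, pair_pair_leibniz]
    ring
  | @whiskerLeft a b c s hs ih =>
    change Z ◁ _ ◁ s ≫ leibniz _ _ _ _ = leibniz _ _ _ _
    refine pair_pair_ext' fun G _ _ z p q => ?_
    simp only [pair_whiskerLeft_assoc, pair_whiskerLeft, pair_pair_leibniz, ← ih,
      Category.assoc, ev_move inc hs]

variable [HasColimits C] [∀ X : C, PreservesColimits (tensorLeft X)] {inc : x ⟶ S}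

namespace IsFreeCommMon

/-- Words generate, and the Leibniz rule propagates the vanishing from the letters to all words by
induction. -/
theorem der_eq_zero (h : IsFreeCommMon inc) {D : Z ⊗ S ⟶ S} (hD : IsDer D)
    (h₀ : Z ◁ inc ≫ D = 0) : D = 0 := by
  refine h.hom_ext fun w => ?_
  rw [comp_zero]
  induction w with
  | letter => exact h₀
  | unit => exact hD.unit
  | mul a b iha ihb =>
    change Z ◁ ((ev inc a ⊗ₘ ev inc b) ≫ μ[S]) ≫ D = 0
    refine pair_pair_ext' fun G _ _ z p q => ?_
    have ha : pair z (p ≫ ev inc a) ≫ D = 0 := by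
      rw [← pair_whiskerLeft_assoc, iha, comp_zero]
    have hb : pair z (q ≫ ev inc b) ≫ D = 0 := by
      rw [← pair_whiskerLeft_assoc, ihb, comp_zero]
    simp [hD G, ha, hb]

theorem hom_ext_pair (h : IsFreeCommMon inc) {f g : Z ⊗ (S ⊗ S) ⟶ M}
    (H : ∀ a b, Z ◁ (ev inc a ⊗ₘ ev inc b) ≫ f = Z ◁ (ev inc a ⊗ₘ ev inc b) ≫ g) : f = g := by
  rw [← cancel_epi (α_ Z S S).hom]
  refine h.hom_ext fun b => ?_
  rw [← cancel_epi (α_ _ _ _).inv, ← cancel_epi (Z ◁ (β_ _ _).hom), ← cancel_epi (α_ _ _ _).hom]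
  refine h.hom_ext fun a => pair_pair_ext fun G _ _ z q p => ?_
  simpa using pair z (pair p q) ≫= H a b

theorem exists_der (h : IsFreeCommMon inc) (φ : Z ⊗ x ⟶ S) :
    ∃ D : Z ⊗ S ⟶ S, IsDer D ∧ Z ◁ inc ≫ D = φ := by
  obtain ⟨D, hD⟩ := h.exists_desc (compatible_derWord inc φ)
  refine ⟨D, ?_, hD .letter⟩
  have e : Z ◁ μ[S] ≫ D = leibniz D (𝟙 S) D (𝟙 S) := h.hom_ext_pair fun a b => by
    have := hD (a.mul b)
    change Z ◁ ((ev inc a ⊗ₘ ev inc b) ≫ μ[S]) ≫ D = leibniz _ _ _ _ at this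
    rw [← whiskerLeft_comp_assoc, this]
    refine pair_pair_ext' fun G _ _ z p q => ?_
    simp [pair_pair_leibniz, ← hD]
  intro G _ _ z s t
  have := pair z (pair s t) ≫= e
  simp only [pair_whiskerLeft_assoc, pair_mul, pair_pair_leibniz, Category.comp_id] at this
  rw [this]
  ring

theorem biDerivation_eq_zero (h : IsFreeCommMon inc) {B : S ⊗ S ⟶ S} (hB : IsBiDerivation B)
    (h₀ : (inc ⊗ₘ inc) ≫ B = 0) : B = 0 := by
  rw [isBiDerivation_iff] at hB
  have h₁ : inc ▷ S ≫ B = 0 := h.der_eq_zero (hB.2.precomp inc) (by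
    rwa [← MonoidalCategory.tensorHom_def'_assoc])
  rw [← cancel_epi (β_ S S).hom, comp_zero]
  refine h.der_eq_zero hB.1 ?_
  rw [BraidedCategory.braiding_naturality_right_assoc, h₁, comp_zero]

/-- The generator map is extended first in its second variable, then, after a swap, in the other.
What remains is that the second extension preserves the derivation property already obtained in the
first. -/
theorem exists_biDerivation (h : IsFreeCommMon inc) (φ : x ⊗ x ⟶ S) :
    ∃ B : S ⊗ S ⟶ S, IsBiDerivation B ∧ (inc ⊗ₘ inc) ≫ B = φ := by
  obtain ⟨D, hD, hφ⟩ := h.exists_der φ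
  obtain ⟨E, hE, hD'⟩ := h.exists_der ((β_ S x).hom ≫ D)
  have key : ∀ (G : C) [ComonObj G] [IsCommComonObj G] (s : G ⟶ S) (w : G ⟶ x),
      pair s (w ≫ inc) ≫ E = pair w s ≫ D := fun G _ _ s w => by
    rw [← pair_whiskerLeft_assoc, hD', pair_braiding_assoc]
  refine ⟨(β_ S S).hom ≫ E, (isBiDerivation_iff _).2 ⟨by simpa using hE, ?_⟩, ?_⟩
  -- `F(s, t, r)` measures the failure of the Leibniz rule in the first variable of `E`. It is a
  -- derivation in `r`, and for `r` a generator it vanishes because `D` is a derivation; hence `F =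
  -- 0`.
  · let F : (S ⊗ S) ⊗ S ⟶ S := μ[S] ▷ S ≫ E - (α_ _ _ _).hom ≫ S ◁ E ≫ μ[S] -
      (β_ S S).hom ▷ S ≫ (α_ _ _ _).hom ≫ S ◁ E ≫ μ[S]
    have hF : ∀ (G : C) [ComonObj G] [IsCommComonObj G] (s t r : G ⟶ S),
        pair (pair s t) r ≫ F = pair (s * t) r ≫ E - s * (pair t r ≫ E) - t * (pair s r ≫ E) :=
      fun G _ _ s t r => by simp [F, Preadditive.comp_sub]
    have hF₀ : F = 0 := by
      refine h.der_eq_zero (IsDer.of_pair fun G _ _ s t r r' => ?_)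
        (pair_pair_ext fun G _ _ s t w => ?_)
      · simp only [hF, hE G]
        ring
      · rw [pair_whiskerLeft_assoc, hF, key, key, key, hD G, comp_zero]
        ring
    intro G _ _ r s t
    have := hF G s t r
    rw [hF₀, comp_zero] at this
    simp only [pair_braiding_assoc]
    linear_combination -this
  · refine pair_ext fun G _ _ w w' => ?_
    rw [pair_tensorHom_assoc, pair_braiding_assoc, key, ← pair_whiskerLeft_assoc, hφ]

end IsFreeCommMon

end Extend

end Derivations

/-! ### Reduction of the Poisson axioms to generators -/

section Poisson

variable {C : Type u} [Category.{v} C] [MonoidalCategory C] [SymmetricCategory C]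
  [Preadditive C] [MonoidalPreadditive C]
  {S : C} [MonObj S] [IsCommMonObj S] {x : C}

/-- The Jacobiator of a bracket. -/
def jacobiator (B : S ⊗ S ⟶ S) : S ⊗ (S ⊗ S) ⟶ S := cyclicSymmetriser S ≫ S ◁ B ≫ B

theorem pair_jacobiator {G : C} [ComonObj G] [IsCommComonObj G] (B : S ⊗ S ⟶ S) (s t r : G ⟶ S) :
    pair s (pair t r) ≫ jacobiator B = pair s (pair t r ≫ B) ≫ B + pair t (pair r s ≫ B) ≫ B +
      pair r (pair s t ≫ B) ≫ B := by
  simp [jacobiator, cyclicSymmetriser, cyc, Preadditive.add_comp, Preadditive.comp_add]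

theorem pair_jacobiator_rotate {G : C} [ComonObj G] [IsCommComonObj G] (B : S ⊗ S ⟶ S)
    (s t r : G ⟶ S) :
    pair s (pair t r) ≫ jacobiator B = pair t (pair r s) ≫ jacobiator B := by
  rw [pair_jacobiator, pair_jacobiator]; ring

variable [HasBinaryBiproducts C]

/-- Expanding by Leibniz in both brackets, the products of two single brackets cancel by
antisymmetry, which also supplies the Leibniz rule in the first variable. -/
theorem isDer_jacobiator {B : S ⊗ S ⟶ S} (hB : IsDer B) (hB' : (β_ S S).hom ≫ B = -B) :
    IsDer ((α_ S S S).hom ≫ jacobiator B) := by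
  have anti : ∀ (G : C) [ComonObj G] [IsCommComonObj G] (s t : G ⟶ S),
      pair s t ≫ B = -(pair t s ≫ B) := fun G _ _ s t => by
    rw [← pair_braiding_assoc, hB', Preadditive.comp_neg]
  refine IsDer.of_pair fun G _ _ s t r r' => ?_
  simp only [pair_associator_hom_assoc, pair_jacobiator]
  have e₁ : pair (r * r') (pair s t ≫ B) ≫ B =
      r * (pair r' (pair s t ≫ B) ≫ B) + r' * (pair r (pair s t ≫ B) ≫ B) := by
    rw [anti, hB, anti _ r', anti _ r]; ring
  have e₂ : pair (r * r') s ≫ B = r * (pair r' s ≫ B) + r' * (pair r s ≫ B) := by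
    rw [anti, hB, anti _ r', anti _ r]; ring
  rw [e₁, e₂, hB]
  simp only [pair_add, Preadditive.add_comp, hB G]
  rw [anti _ r' s, anti _ r s]
  simp only [pair_neg, Preadditive.neg_comp]
  ring

variable [HasColimits C] [∀ X : C, PreservesColimits (tensorLeft X)] {inc : x ⟶ S}

namespace IsFreeCommMon

theorem antisymm (h : IsFreeCommMon inc) {B : S ⊗ S ⟶ S} (hB : IsBiDerivation B)
    (H : (inc ⊗ₘ inc) ≫ (β_ S S).hom ≫ B = -((inc ⊗ₘ inc) ≫ B)) : (β_ S S).hom ≫ B = -B := by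
  rw [← add_eq_zero_iff_eq_neg]
  refine h.biDerivation_eq_zero ?_ (by simp [Preadditive.comp_add, H])
  rw [isBiDerivation_iff] at hB ⊢
  refine ⟨?_, hB.1.add hB.2⟩
  rw [Preadditive.comp_add, SymmetricCategory.symmetry_assoc]
  exact hB.2.add hB.1

/-- The variables are freed from generators one at a time; cyclic invariance of the Jacobiator
brings each in turn to the last place, where it is a derivation. -/
theorem jacobiator_eq_zero (h : IsFreeCommMon inc) {B : S ⊗ S ⟶ S} (hB : IsDer B)
    (hB' : (β_ S S).hom ≫ B = -B) (H : (inc ⊗ₘ (inc ⊗ₘ inc)) ≫ jacobiator B = 0) :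
    jacobiator B = 0 := by
  have hJ := isDer_jacobiator hB hB'
  have h₁ : (inc ⊗ₘ inc) ▷ S ≫ (α_ S S S).hom ≫ jacobiator B = 0 :=
    h.der_eq_zero (hJ.precomp _) (by
      rw [← MonoidalCategory.tensorHom_def'_assoc, associator_naturality_assoc, H, comp_zero])
  have h₂ : inc ▷ S ▷ S ≫ (α_ S S S).hom ≫ jacobiator B = 0 :=
    h.der_eq_zero (hJ.precomp _) (pair_pair_ext fun G _ _ p s q => by
      have := pair (pair q p) s ≫= h₁
      simp only [pair_whiskerRight_assoc, pair_tensorHom, pair_associator_hom_assoc,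
        comp_zero] at this
      simp only [pair_whiskerLeft_assoc, pair_whiskerRight_assoc, pair_whiskerRight,
        pair_associator_hom_assoc, comp_zero]
      rw [pair_jacobiator_rotate, pair_jacobiator_rotate, this])
  have h₃ : (α_ S S S).hom ≫ jacobiator B = 0 :=
    h.der_eq_zero hJ (pair_pair_ext fun G _ _ s t q => by
      have := pair (pair q s) t ≫= h₂
      simp only [pair_whiskerRight_assoc, pair_whiskerRight, pair_associator_hom_assoc,
        comp_zero] at this
      simp only [pair_whiskerLeft_assoc, pair_associator_hom_assoc, comp_zero]
      rw [pair_jacobiator_rotate, pair_jacobiator_rotate, this])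
  rwa [Preadditive.IsIso.comp_left_eq_zero] at h₃

end IsFreeCommMon

end Poisson

/-! ### Contraction against a point: formal sums over dual bases -/

section Sums

variable {C : Type u} [Category.{v} C] [MonoidalCategory C] [SymmetricCategory C]
variable {G H H' X Y Z W : C} [ComonObj G] [ComonObj H] [ComonObj H']
  [IsCommComonObj G] [IsCommComonObj H] [IsCommComonObj H']

@[simp]
theorem pair_tensorμ (a : G ⟶ X) (b : G ⟶ Y) (c : G ⟶ Z) (d : G ⟶ W) :
    pair (pair a b) (pair c d) ≫ tensorμ X Y Z W = pair (pair a c) (pair b d) := by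
  simp [tensorμ]

@[simp]
theorem pair_tensorμ_assoc (a : G ⟶ X) (b : G ⟶ Y) (c : G ⟶ Z) (d : G ⟶ W) {T : C}
    (h : (X ⊗ Z) ⊗ (Y ⊗ W) ⟶ T) :
    pair (pair a b) (pair c d) ≫ tensorμ X Y Z W ≫ h = pair (pair a c) (pair b d) ≫ h := by
  rw [← Category.assoc, pair_tensorμ]

theorem comul_eq_pair : Δ[G] = pair (𝟙 G) (𝟙 G) := by simp [pair]

/-- Cocommutativity of `G` is needed here: the two middle copies of the parameter are exchanged. -/
instance (p : G ⟶ H) (q : G ⟶ H') [IsComonHom p] [IsComonHom q] : IsComonHom (pair p q) where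
  hom_counit := by
    rw [Comon.tensorObj_counit, pair_tensorHom_assoc, IsComonHom.hom_counit,
      IsComonHom.hom_counit, pair_counit_leftUnitor]
  hom_comul := by
    rw [Comon.tensorObj_comul, pair_tensorHom_assoc, comul_eq_pair, comul_eq_pair, comp_pair,
      comp_pair, Category.comp_id, Category.comp_id, pair_tensorμ]
    rfl

@[simp]
theorem pair_fst (p : G ⟶ H) (q : G ⟶ H') [IsComonHom q] : pair p q ≫ fst H H' = p := by
  simp [fst]

@[simp]
theorem pair_fst_assoc (p : G ⟶ H) (q : G ⟶ H') [IsComonHom q] {T : C} (h : H ⟶ T) :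
    pair p q ≫ fst H H' ≫ h = p ≫ h := by
  rw [← Category.assoc, pair_fst]

@[simp]
theorem pair_snd (p : G ⟶ H) (q : G ⟶ H') [IsComonHom p] : pair p q ≫ snd H H' = q := by
  simp [snd]

@[simp]
theorem pair_snd_assoc (p : G ⟶ H) (q : G ⟶ H') [IsComonHom p] {T : C} (h : H' ⟶ T) :
    pair p q ≫ snd H H' ≫ h = q ≫ h := by
  rw [← Category.assoc, pair_snd]

/-- Contraction of the variable `H` of `f` against a point `θ` of `H`. -/
def contract (θ : 𝟙_ C ⟶ H) (f : G ⊗ H ⟶ X) : G ⟶ X := pair (𝟙 G) (ε[G] ≫ θ) ≫ f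

variable (θ : 𝟙_ C ⟶ H) (θ' : 𝟙_ C ⟶ H')

theorem contract_comp (f : G ⊗ H ⟶ X) (g : X ⟶ Y) : contract θ f ≫ g = contract θ (f ≫ g) := by
  simp [contract]

theorem contract_snd_comp (f : H ⟶ X) : contract θ (snd G H ≫ f) = ε[G] ≫ θ ≫ f := by
  simp [contract]

theorem pair_fst_comp (y : G ⟶ Y) (f : G ⊗ H ⟶ X) :
    pair (fst G H ≫ y) f = Δ[G] ▷ H ≫ (α_ G G H).hom ≫ (y ⊗ₘ f) := by
  have h : Δ[G] ▷ H = pair (pair (fst G H) (fst G H)) (snd G H) := by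
    rw [← tensorHom_id, ← pair_fst_comp_snd_comp, comul_eq_pair, comp_pair]
    simp
  rw [h, pair_associator_hom_assoc, pair_fst_snd, pair_tensorHom, Category.id_comp]

/-- A factor independent of the summation variable may be moved under the sum. The point `θ` need
not be a comonoid map, so substitution cannot be distributed over pairs directly. -/
theorem pair_contract (y : G ⟶ Y) (f : G ⊗ H ⟶ X) :
    pair y (contract θ f) = contract θ (pair (fst G H ≫ y) f) := by
  rw [pair_fst_comp, contract, contract, pair_whiskerRight_assoc, Category.id_comp, comul_eq_pair,
    pair_associator_hom_assoc, pair_tensorHom, Category.id_comp]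

theorem contract_pair (y : G ⟶ Y) (f : G ⊗ H ⟶ X) :
    pair (contract θ f) y = contract θ (pair f (fst G H ≫ y)) := by
  rw [← pair_braiding, pair_contract, contract_comp, pair_braiding]

/-- Exchange of the last two variables. -/
def exchange (G H H' : C) [ComonObj G] [ComonObj H] [ComonObj H'] : (G ⊗ H) ⊗ H' ⟶ (G ⊗ H') ⊗ H :=
  pair (pair (fst _ _ ≫ fst _ _) (snd _ _)) (fst _ _ ≫ snd _ _)

/-- Fubini: two independent summations commute. -/
theorem contract_contract (f : (G ⊗ H') ⊗ H ⟶ X) :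
    contract θ' (contract θ f) = contract θ (contract θ' (exchange G H H' ≫ f)) := by
  have key : ∀ {H H' : C} [ComonObj H] [ComonObj H'] [IsCommComonObj H] [IsCommComonObj H']
      (θ : 𝟙_ C ⟶ H) (θ' : 𝟙_ C ⟶ H') {X : C} (f : (G ⊗ H) ⊗ H' ⟶ X),
      contract θ (contract θ' f) = pair (pair (𝟙 G) (ε[G] ≫ θ)) (ε[G] ≫ θ') ≫ f := by
    intro H H' _ _ _ _ θ θ' X f
    have : ε[G ⊗ H] = fst G H ≫ ε[G] := by rw [IsComonHom.hom_counit]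
    have h : contract θ' f = pair (𝟙 (G ⊗ H)) (ε[G ⊗ H] ≫ θ') ≫ f := rfl
    rw [h, this, ← contract_comp, Category.assoc, ← contract_pair, contract, Category.comp_id]
  have hex : exchange G H H' =
      (α_ _ _ _).hom ≫ G ◁ (β_ _ _).hom ≫ (α_ _ _ _).inv := by
    have : 𝟙 ((G ⊗ H) ⊗ H') = pair (pair (fst _ _ ≫ fst _ _) (fst _ _ ≫ snd _ _)) (snd _ _) := by
      rw [← comp_pair, pair_fst_snd, Category.comp_id, pair_fst_snd]
    rw [← Category.id_comp (_ ≫ _), this]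
    simp [exchange]
  rw [key, key, hex]
  simp

/-- The rigorous form of `e = ∑ k ⊗ l`: the summation index is a variable in the comonoid `H`, and
`θ` prescribes the sum. -/
theorem exists_expansion [Preadditive C] [MonoidalPreadditive C] [HasBinaryBiproducts C]
    (e : 𝟙_ C ⟶ X ⊗ Y) : ∃ (H : C) (_ : ComonObj H) (_ : IsCommComonObj H) (θ : 𝟙_ C ⟶ H)
      (k : H ⟶ X) (l : H ⟶ Y), θ ≫ pair k l = e :=
  ⟨Gen X ⊗ Gen Y, inferInstance, inferInstance, e ≫ (Gen.inc X ⊗ₘ Gen.inc Y),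
    fst _ _ ≫ Gen.elt X, snd _ _ ≫ Gen.elt Y, by simp [pair_fst_comp_snd_comp]⟩

theorem counit_comp_eq_contract {θ : 𝟙_ C ⟶ H} {k : H ⟶ X} {l : H ⟶ Y} {e : 𝟙_ C ⟶ X ⊗ Y}
    (he : θ ≫ pair k l = e) : ε[G] ≫ e = contract θ (pair (snd G H ≫ k) (snd G H ≫ l)) := by
  rw [← comp_pair, contract_snd_comp, he]

variable [Preadditive C] [MonoidalPreadditive C] {S : C} [MonObj S] [IsCommMonObj S]

theorem contract_zsmul (n : ℤ) (f : G ⊗ H ⟶ X) : contract θ (n • f) = n • contract θ f := by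
  simp [contract]

theorem mul_contract (s : G ⟶ S) (f : G ⊗ H ⟶ S) :
    s * contract θ f = contract θ ((fst G H ≫ s) * f) := by
  rw [← pair_mul, pair_contract, contract_comp, pair_mul]

theorem contract_mul (s : G ⟶ S) (f : G ⊗ H ⟶ S) :
    contract θ f * s = contract θ (f * (fst G H ≫ s)) := by
  rw [← pair_mul, contract_pair, contract_comp, pair_mul]

end Sums

/-! ### Matrix products and the quartic expression -/

section Path

variable {C : Type u} [Category.{v} C] [MonoidalCategory C] [SymmetricCategory C]
  {S : C} [MonObj S] {X Y K K' L L' : C}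

/-- The matrix product of two `S`-valued forms, contracted along `e : 𝟙 ⟶ K ⊗ K'`. -/
def matMul (e : 𝟙_ C ⟶ K ⊗ K') (A : X ⊗ K' ⟶ S) (B : K ⊗ Y ⟶ S) : X ⊗ Y ⟶ S :=
  (ρ_ _).inv ≫ (X ⊗ Y) ◁ (e ≫ (β_ K K').hom) ≫ tensorμ X Y K' K ≫ (A ⊗ₘ (β_ Y K).hom ≫ B) ≫ μ[S]

variable [IsCommMonObj S] [Preadditive C] [MonoidalPreadditive C]
  {G : C} [ComonObj G] [IsCommComonObj G]

theorem pair_matMul {H : C} [ComonObj H] [IsCommComonObj H] {θ : 𝟙_ C ⟶ H} {k : H ⟶ K} {l : H ⟶ K'}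
    {e : 𝟙_ C ⟶ K ⊗ K'} (he : θ ≫ pair k l = e) (A : X ⊗ K' ⟶ S) (B : K ⊗ Y ⟶ S)
    (p : G ⟶ X) (q : G ⟶ Y) : pair p q ≫ matMul e A B =
      contract θ ((pair (fst G H ≫ p) (snd G H ≫ l) ≫ A) *
        (pair (snd G H ≫ k) (fst G H ≫ q) ≫ B)) := by
  simp only [matMul, comp_rightUnitor_inv_assoc, pair_whiskerLeft_assoc, ← Category.assoc ε[G],
    counit_comp_eq_contract he]
  rw [contract_comp, pair_braiding, pair_contract, contract_comp, comp_pair]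
  simp

/-- Both sides are the same double sum, up to the order of summation. -/
theorem matMul_assoc [HasBinaryBiproducts C] (e : 𝟙_ C ⟶ K ⊗ K') (e' : 𝟙_ C ⟶ L ⊗ L')
    (A : X ⊗ K' ⟶ S) (B : K ⊗ L' ⟶ S) (D : L ⊗ Y ⟶ S) :
    matMul e A (matMul e' B D) = matMul e' (matMul e A B) D := by
  obtain ⟨H, _, _, θ, k, k', he⟩ := exists_expansion e
  obtain ⟨H', _, _, θ', l, l', he'⟩ := exists_expansion e'
  refine pair_ext fun G _ _ p q => ?_
  simp only [pair_matMul he, pair_matMul he', mul_contract, contract_mul]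
  rw [contract_contract]
  congr 2
  simp only [comp_mul, comp_pair_assoc, exchange, pair_fst_assoc, pair_snd_assoc,
    Category.assoc]
  ring

/-- In the sum of `A(p, e_kᵛ) A(e_l, p') B(q, e_lᵛ) B(e_k, q')` the indices `k` and `l` separate, so
it factors into entries of `AB` and `BA`. All later computations use this form of the bracket. -/
theorem pair_insertCoev [HasBinaryBiproducts C] {X Y : C} [HasRightDual X] [HasRightDual Y]
    (A : X ⊗ Yᘁ ⟶ S) (B : Y ⊗ Xᘁ ⟶ S)
    (p : G ⟶ X) (p' : G ⟶ Yᘁ) (q : G ⟶ Y) (q' : G ⟶ Xᘁ) :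
    pair (pair p p') (pair q q') ≫ insertCoev X Y ≫ ((A ⊗ₘ A) ⊗ₘ (B ⊗ₘ B)) ≫ mul₄ S =
      (pair p q' ≫ matMul (η_ Y Yᘁ) A B) * (pair q p' ≫ matMul (η_ X Xᘁ) B A) := by
  obtain ⟨H, _, _, θ, k, k', he⟩ := exists_expansion (η_ Y Yᘁ)
  obtain ⟨H', _, _, θ', l, l', he'⟩ := exists_expansion (η_ X Xᘁ)
  have hc : ε[G] ≫ coevPair X Y = contract θ (contract θ'
      (pair (pair (fst _ _ ≫ snd _ _ ≫ k') (snd _ _ ≫ l))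
        (pair (snd _ _ ≫ l') (fst _ _ ≫ snd _ _ ≫ k)))) := by
    rw [coevPair, comp_leftUnitor_inv_assoc, pair_tensorHom_assoc, counit_comp_eq_contract he,
      contract_pair, contract_comp]
    congr 1
    rw [← Category.assoc (fst G H), IsComonHom.hom_counit, counit_comp_eq_contract he',
      pair_contract, contract_comp]
    congr 1
    simp [comp_pair, monoidalComp]
  have key : (pair (pair p p') (pair q q') ≫ insertCoev X Y : G ⟶ _) = contract θ (contract θ'
      (pair (pair (pair (fst _ _ ≫ fst _ _ ≫ p) (fst _ _ ≫ snd _ _ ≫ k'))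
          (pair (snd _ _ ≫ l) (fst _ _ ≫ fst _ _ ≫ p')))
        (pair (pair (fst _ _ ≫ fst _ _ ≫ q) (snd _ _ ≫ l'))
          (pair (fst _ _ ≫ snd _ _ ≫ k) (fst _ _ ≫ fst _ _ ≫ q'))))) := by
    simp only [insertCoev, monoidalComp, MonoidalCoherence.refl_iso,
      MonoidalCoherence.whiskerLeft_iso, MonoidalCoherence.whiskerRight_iso,
      MonoidalCoherence.left'_iso, MonoidalCoherence.assoc_iso, MonoidalCoherence.assoc'_iso,
      Iso.trans_hom, Iso.refl_hom, Iso.symm_hom, whiskerLeftIso_hom, whiskerRightIso_hom,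
      Category.id_comp, Category.comp_id, Category.assoc, pair_whiskerLeft_assoc,
      pair_whiskerLeft, pair_whiskerRight_assoc, pair_whiskerRight, pair_associator_hom_assoc,
      pair_associator_inv_assoc, pair_associator_inv, comp_leftUnitor_inv_assoc, hc,
      contract_pair, pair_contract, contract_comp, comp_pair, pair_braiding]
  rw [reassoc_of% key, contract_comp, contract_comp, QuarticPoisson.pair_matMul he,
    contract_mul]
  congr 1
  rw [comp_pair_assoc, QuarticPoisson.pair_matMul he', mul_contract]
  congr 1
  simp only [mul₄, pair_tensorHom_assoc, pair_tensorHom, pair_mul, comp_mul,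
    comp_pair_assoc]
  ring

end Path

/-! ### The Jacobi identity for an arrow and its reverse -/

section Core

variable {C : Type u} [Category.{v} C] [MonoidalCategory C] [SymmetricCategory C]
  [Preadditive C] [MonoidalPreadditive C] [HasBinaryBiproducts C]
  {S : C} [MonObj S] [IsCommMonObj S] {X X' Y Y' Z : C}

variable {G : C} [ComonObj G] [IsCommComonObj G]

theorem IsDer.pair_matMul {D : Z ⊗ S ⟶ S} (hD : IsDer D) (e : 𝟙_ C ⟶ Y ⊗ Y') (A : X ⊗ Y' ⟶ S)
    (B : Y ⊗ X' ⟶ S) (z : G ⟶ Z) (p : G ⟶ X) (q : G ⟶ X') {H : C} [ComonObj H] [IsCommComonObj H]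
    {θ : 𝟙_ C ⟶ H} {k : H ⟶ Y} {l : H ⟶ Y'} (he : θ ≫ pair k l = e) :
    pair z (pair p q ≫ matMul e A B) ≫ D =
      contract θ
        ((pair (fst G H ≫ p) (snd G H ≫ l) ≫ A) *
          (pair (fst G H ≫ z) (pair (snd G H ≫ k) (fst G H ≫ q) ≫ B) ≫ D) +
         (pair (snd G H ≫ k) (fst G H ≫ q) ≫ B) *
          (pair (fst G H ≫ z) (pair (fst G H ≫ p) (snd G H ≫ l) ≫ A) ≫ D)) := by
  rw [QuarticPoisson.pair_matMul he, pair_contract, contract_comp, hD]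

theorem IsDer.pair_matMul_eq_zero {D : Z ⊗ S ⟶ S} (hD : IsDer D) (e : 𝟙_ C ⟶ Y ⊗ Y')
    (A : X ⊗ Y' ⟶ S) (B : Y ⊗ X' ⟶ S) (hA : Z ◁ A ≫ D = 0) (hB : Z ◁ B ≫ D = 0) (z : G ⟶ Z)
    (p : G ⟶ X) (q : G ⟶ X') : pair z (pair p q ≫ matMul e A B) ≫ D = 0 := by
  obtain ⟨H, _, _, θ, k, k', he⟩ := exists_expansion e
  have hA' : ∀ (G : C) [ComonObj G] (z : G ⟶ Z) (p : G ⟶ _), pair z (p ≫ A) ≫ D = 0 :=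
    fun G _ z p => by rw [← pair_whiskerLeft_assoc, hA, comp_zero]
  have hB' : ∀ (G : C) [ComonObj G] (z : G ⟶ Z) (p : G ⟶ _), pair z (p ≫ B) ≫ D = 0 :=
    fun G _ z p => by rw [← pair_whiskerLeft_assoc, hB, comp_zero]
  rw [hD.pair_matMul e A B z p q he]
  simp [contract, hA', hB']

variable {e : 𝟙_ C ⟶ X ⊗ X'} {e' : 𝟙_ C ⟶ Y ⊗ Y'} {A : X ⊗ Y' ⟶ S} {B : Y ⊗ X' ⟶ S}
  {Br : S ⊗ S ⟶ S} {n : ℤ}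

/-- As `{A, A} = 0`, Leibniz lets the bracket act only on the factor `B` of `AB`; the resulting `BA`
is multiplied by the remaining `A` and gives `A(BA)`. -/
theorem bracket_matMul (hD : IsDer Br) (hA : (A ⊗ₘ A) ≫ Br = 0)
    (hB : ∀ (G : C) [ComonObj G] [IsCommComonObj G] (p : G ⟶ X) (p' : G ⟶ Y') (q : G ⟶ Y)
      (q' : G ⟶ X'), pair (pair p p' ≫ A) (pair q q' ≫ B) ≫ Br =
        n • ((pair p q' ≫ matMul e' A B) * (pair q p' ≫ matMul e B A)))
    (p : G ⟶ X) (p' : G ⟶ Y') (q q' : _) :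
    pair (pair p p' ≫ A) (pair q q' ≫ matMul e' A B) ≫ Br =
      n • ((pair p q' ≫ matMul e' A B) * (pair q p' ≫ matMul e' A (matMul e B A))) := by
  obtain ⟨H, _, _, θ, k, k', he⟩ := exists_expansion e'
  rw [hD.pair_matMul _ _ _ _ _ _ he]
  have hA' : ∀ (G : C) [ComonObj G] (p q : G ⟶ _), pair (p ≫ A) (q ≫ A) ≫ Br = 0 :=
    fun G _ p q => by rw [← pair_tensorHom_assoc, hA, comp_zero]
  rw [QuarticPoisson.pair_matMul he A (matMul e B A), mul_contract, ← contract_zsmul]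
  congr 1
  simp only [comp_pair_assoc, hB, hA', mul_zero, add_zero, zsmul_eq_mul]
  ring

theorem bracket_matMul' (hD : IsDer Br) (hA : (A ⊗ₘ A) ≫ Br = 0)
    (hB : ∀ (G : C) [ComonObj G] [IsCommComonObj G] (p : G ⟶ X) (p' : G ⟶ Y') (q : G ⟶ Y)
      (q' : G ⟶ X'), pair (pair p p' ≫ A) (pair q q' ≫ B) ≫ Br =
        n • ((pair p q' ≫ matMul e' A B) * (pair q p' ≫ matMul e B A)))
    (p : G ⟶ X) (p' : G ⟶ Y') (q q' : _) :
    pair (pair p p' ≫ A) (pair q q' ≫ matMul e B A) ≫ Br =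
      n • ((pair q p' ≫ matMul e B A) * (pair p q' ≫ matMul e (matMul e' A B) A)) := by
  obtain ⟨H, _, _, θ, k, k', he⟩ := exists_expansion e
  rw [hD.pair_matMul _ _ _ _ _ _ he]
  have hA' : ∀ (G : C) [ComonObj G] (p q : G ⟶ _), pair (p ≫ A) (q ≫ A) ≫ Br = 0 :=
    fun G _ p q => by rw [← pair_tensorHom_assoc, hA, comp_zero]
  rw [QuarticPoisson.pair_matMul he (matMul e' A B) A, mul_contract, ← contract_zsmul]
  congr 1
  simp only [comp_pair_assoc, hB, hA', mul_zero, zero_add, zsmul_eq_mul]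
  ring

/-- The double bracket of two entries of `A` with one of `B` is symmetric in the two entries of `A`,
so two terms of the Jacobiator cancel; the third contains `{A, A} = 0`. -/
theorem pair_jacobiator_eq_zero (hD : IsDer Br) (anti : (β_ S S).hom ≫ Br = -Br)
    (hA : (A ⊗ₘ A) ≫ Br = 0)
    (hB : ∀ (G : C) [ComonObj G] [IsCommComonObj G] (p : G ⟶ X) (p' : G ⟶ Y') (q : G ⟶ Y)
      (q' : G ⟶ X'), pair (pair p p' ≫ A) (pair q q' ≫ B) ≫ Br =
        n • ((pair p q' ≫ matMul e' A B) * (pair q p' ≫ matMul e B A))) :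
    (A ⊗ₘ (A ⊗ₘ B)) ≫ jacobiator Br = 0 := by
  have hA' : ∀ (G : C) [ComonObj G] (p q : G ⟶ _), pair (p ≫ A) (q ≫ A) ≫ Br = 0 :=
    fun G _ p q => by rw [← pair_tensorHom_assoc, hA, comp_zero]
  refine pair_pair_pair_pair_pair_ext fun G _ _ p p' q q' r r' => ?_
  have hBA : pair (pair r r' ≫ B) (pair p p' ≫ A) ≫ Br =
      -(n • ((pair p r' ≫ matMul e' A B) * (pair r p' ≫ matMul e B A))) := by
    rw [← hB, ← Preadditive.comp_neg, ← anti, pair_braiding_assoc]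
  rw [pair_tensorHom_assoc, pair_tensorHom, pair_jacobiator, hB, hA', hBA, comp_zero]
  simp only [pair_neg, Preadditive.neg_comp, pair_zero, zero_comp, add_zero]
  have hz : ∀ s t : G ⟶ S, pair s (n • t) ≫ Br = n • (pair s t ≫ Br) := fun s t => by
    rw [← Preadditive.zsmul_comp, pair_zsmul]
  -- Associativity identifies `A(BA)` with `(AB)A`, which come from the two factors of the bracket;
  -- only commutative ring algebra is left.
  rw [hz, hz, hD, hD, bracket_matMul hD hA hB, bracket_matMul' hD hA hB,
    bracket_matMul hD hA hB, bracket_matMul' hD hA hB, matMul_assoc]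
  simp only [zsmul_eq_mul]
  ring

end Core

/-! ### The involution and the pairing on the double quiver -/

namespace DoubleArrow

variable {V : Type*} [Quiver V]

theorem bar_bar (a : DoubleArrow V) : a.bar.bar = a := by
  obtain ⟨i, j, e | e⟩ := a <;> rfl

theorem not_isOriginal_bar {a : DoubleArrow V} (h : a.IsOriginal) : ¬ a.bar.IsOriginal := by
  rintro ⟨i, j, e, he⟩
  obtain ⟨i', j', e', rfl⟩ := h
  cases he

theorem isOriginal_or (a : DoubleArrow V) : a.IsOriginal ∨ a.bar.IsOriginal := by
  obtain ⟨i, j, e | e⟩ := a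
  · exact .inl ⟨i, j, e, rfl⟩
  · exact .inr ⟨j, i, e, rfl⟩

/-- True even for loops, since the double contains a separate reverse of each arrow; it yields `{A,
A} = 0` for the generators of a single arrow. -/
theorem ne_bar (a : DoubleArrow V) : a ≠ a.bar := by
  intro h
  rcases a.isOriginal_or with ha | ha
  · exact not_isOriginal_bar ha (h ▸ ha)
  · exact not_isOriginal_bar (h ▸ ha) ha

theorem pairing_bar_left (a : DoubleArrow V) : a.bar.pairing a = -a.pairing a.bar := by
  rcases a.isOriginal_or with ha | ha
  · simp [pairing, ha, not_isOriginal_bar ha]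
  · have ha' : ¬ a.IsOriginal := fun h => not_isOriginal_bar h ha
    simp [pairing, ha, ha', bar_bar]

end DoubleArrow

/-! ### Maps out of tensor powers of a finite biproduct -/

section Biproduct

variable {C : Type u} [Category.{v} C] [MonoidalCategory C] [SymmetricCategory C]
  [Preadditive C] [MonoidalPreadditive C] [HasFiniteBiproducts C] {J : Type*} [Finite J]
  {F : J → C} {M : C}

theorem sum_π_comp_ι [Fintype J] : ∑ j, biproduct.π F j ≫ biproduct.ι F j = 𝟙 (⨁ F) := by
  classical
  refine biproduct.hom_ext' _ _ fun a => ?_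
  rw [Preadditive.comp_sum, Finset.sum_eq_single a]
  · simp
  · intro b _ hb
    rw [biproduct.ι_π_ne_assoc _ hb.symm, zero_comp]
  · simp

theorem biproduct_tensor_ext {f g : (⨁ F) ⊗ (⨁ F) ⟶ M}
    (h : ∀ a b, (biproduct.ι F a ⊗ₘ biproduct.ι F b) ≫ f =
      (biproduct.ι F a ⊗ₘ biproduct.ι F b) ≫ g) : f = g := by
  have := Fintype.ofFinite J
  have e : 𝟙 ((⨁ F) ⊗ (⨁ F)) = ∑ a, ∑ b, (biproduct.π F a ⊗ₘ biproduct.π F b) ≫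
      (biproduct.ι F a ⊗ₘ biproduct.ι F b) := by
    simp only [tensorHom_comp_tensorHom, ← tensor_sum, ← sum_tensor]
    rw [sum_π_comp_ι]
    simp
  rw [← Category.id_comp f, ← Category.id_comp g, e]
  simp only [Preadditive.sum_comp, Category.assoc, h]

theorem biproduct_tensor_tensor_ext {f g : (⨁ F) ⊗ ((⨁ F) ⊗ (⨁ F)) ⟶ M}
    (h : ∀ a b c, (biproduct.ι F a ⊗ₘ (biproduct.ι F b ⊗ₘ biproduct.ι F c)) ≫ f =
      (biproduct.ι F a ⊗ₘ (biproduct.ι F b ⊗ₘ biproduct.ι F c)) ≫ g) : f = g := by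
  have := Fintype.ofFinite J
  have e : 𝟙 ((⨁ F) ⊗ ((⨁ F) ⊗ (⨁ F))) = ∑ a, ∑ b, ∑ c,
      (biproduct.π F a ⊗ₘ (biproduct.π F b ⊗ₘ biproduct.π F c)) ≫
        (biproduct.ι F a ⊗ₘ (biproduct.ι F b ⊗ₘ biproduct.ι F c)) := by
    simp only [tensorHom_comp_tensorHom, ← tensor_sum, ← sum_tensor]
    rw [sum_π_comp_ι]
    simp
  rw [← Category.id_comp f, ← Category.id_comp g, e]
  simp only [Preadditive.sum_comp, Category.assoc, h]

theorem exists_biproduct_tensor_desc (q : ∀ a b, F a ⊗ F b ⟶ M) :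
    ∃ f : (⨁ F) ⊗ (⨁ F) ⟶ M, ∀ a b, (biproduct.ι F a ⊗ₘ biproduct.ι F b) ≫ f = q a b := by
  classical
  have := Fintype.ofFinite J
  refine ⟨∑ a, ∑ b, (biproduct.π F a ⊗ₘ biproduct.π F b) ≫ q a b, fun a b => ?_⟩
  simp only [Preadditive.comp_sum, tensorHom_comp_tensorHom_assoc]
  rw [Finset.sum_eq_single a, Finset.sum_eq_single b]
  · simp
  · intro b' _ hb
    rw [biproduct.ι_π_ne _ hb.symm]
    simp
  · simp
  · intro a' _ ha
    refine Finset.sum_eq_zero fun b' _ => ?_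
    rw [biproduct.ι_π_ne _ ha.symm]
    simp
  · simp

end Biproduct

/-! ### The quartic bracket -/

section Quartic

instance {C : Type u} [Category.{v} C] [Preadditive C] [HasColimits C] : HasBinaryBiproducts C :=
  hasBinaryBiproducts_of_finite_biproducts C

variable {C : Type u} [Category.{v} C] [MonoidalCategory C] [SymmetricCategory C]
  [Preadditive C] [MonoidalPreadditive C] [HasColimits C]
  [∀ X : C, PreservesColimits (tensorLeft X)]
  {V : Type*} [Quiver V] [Finite V] [∀ i j : V, Finite (i ⟶ j)]
  {c : V → C} [∀ i, HasRightDual (c i)] {S : C} [MonObj S] [IsCommMonObj S] {inc : hDual c ⟶ S}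

namespace IsQuarticBracket

variable {B : S ⊗ S ⟶ S}

theorem gen_gen_of_ne (hB : IsQuarticBracket c inc B) {a b : DoubleArrow V} (h : b ≠ a.bar) :
    (gen c inc a ⊗ₘ gen c inc b) ≫ B = 0 := by
  rw [hB.component, quarticComponent, dif_neg h]

theorem gen_gen_bar (hB : IsQuarticBracket c inc B) (a : DoubleArrow V) {G : C} [ComonObj G]
    [IsCommComonObj G]
    (p : G ⟶ c a.src) (p' : G ⟶ (c a.tgt)ᘁ) (q : G ⟶ c a.tgt) (q' : G ⟶ (c a.src)ᘁ) :
    pair (pair p p' ≫ gen c inc a) (pair q q' ≫ gen c inc a.bar) ≫ B =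
      a.pairing a.bar • ((pair p q' ≫
        matMul (η_ (c a.tgt) (c a.tgt)ᘁ) (gen c inc a) (gen c inc a.bar)) *
        (pair q p' ≫ matMul (η_ (c a.src) (c a.src)ᘁ) (gen c inc a.bar) (gen c inc a))) := by
  rw [← pair_tensorHom_assoc, hB.component, quarticComponent, dif_pos rfl, eqToHom_refl,
    Category.id_comp, Preadditive.comp_zsmul, quarticAt]
  congr 1
  exact pair_insertCoev _ _ _ _ _ _

theorem gen_bar_gen (hB : IsQuarticBracket c inc B) (a : DoubleArrow V) {G : C} [ComonObj G]
    [IsCommComonObj G]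
    (p : G ⟶ c a.src) (p' : G ⟶ (c a.tgt)ᘁ) (q : G ⟶ c a.tgt) (q' : G ⟶ (c a.src)ᘁ) :
    pair (pair q q' ≫ gen c inc a.bar) (pair p p' ≫ gen c inc a) ≫ B =
      a.bar.pairing a • ((pair q p' ≫
        matMul (η_ (c a.src) (c a.src)ᘁ) (gen c inc a.bar) (gen c inc a)) *
        (pair p q' ≫ matMul (η_ (c a.tgt) (c a.tgt)ᘁ) (gen c inc a) (gen c inc a.bar))) := by
  -- Once the arrow is split into its two kinds, `a.bar.bar` reduces to `a` by definition and no
  -- transport along `bar_bar` is needed.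
  obtain ⟨i, j, e | e⟩ := a
  · exact hB.gen_gen_bar ⟨j, i, .inr e⟩ q q' p p'
  · exact hB.gen_gen_bar ⟨j, i, .inl e⟩ q q' p p'

theorem antisymm (hB : IsQuarticBracket c inc B) (h : IsFreeCommMon inc) :
    (β_ S S).hom ≫ B = -B := by
  refine h.antisymm hB.biDerivation (biproduct_tensor_ext fun a b => ?_)
  rw [Preadditive.comp_neg, tensorHom_comp_tensorHom_assoc, tensorHom_comp_tensorHom_assoc]
  change (gen c inc a ⊗ₘ gen c inc b) ≫ (β_ S S).hom ≫ B = -((gen c inc a ⊗ₘ gen c inc b) ≫ B)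
  by_cases hab : b = a.bar
  · subst hab
    refine pair_pair_pair_ext fun G _ _ p p' q q' => ?_
    rw [Preadditive.comp_neg, pair_tensorHom_assoc, pair_tensorHom_assoc, pair_braiding_assoc,
      hB.gen_gen_bar, hB.gen_bar_gen, a.pairing_bar_left, neg_smul, _root_.mul_comm]
  · have hba : a ≠ b.bar := fun h => hab (by rw [h, DoubleArrow.bar_bar])
    rw [BraidedCategory.braiding_naturality_assoc, hB.gen_gen_of_ne hab, hB.gen_gen_of_ne hba]
    simp

theorem gen_gen_gen_bar (hB : IsQuarticBracket c inc B) (h : IsFreeCommMon inc)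
    {a b : DoubleArrow V} (hab : b = a.bar) :
    (gen c inc a ⊗ₘ (gen c inc a ⊗ₘ gen c inc b)) ≫ jacobiator B = 0 := by
  subst hab
  exact pair_jacobiator_eq_zero ((isBiDerivation_iff B).1 hB.biDerivation).2 (hB.antisymm h)
    (hB.gen_gen_of_ne a.ne_bar) fun G _ _ => hB.gen_gen_bar a

theorem pair_gen_of_ne (hB : IsQuarticBracket c inc B) {a b : DoubleArrow V} (h : b ≠ a.bar)
    {G : C} [ComonObj G]
    (p : G ⟶ hDualAt c a) (q : G ⟶ hDualAt c b) :
    pair (p ≫ gen c inc a) (q ≫ gen c inc b) ≫ B = 0 := by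
  rw [← pair_tensorHom_assoc, hB.gen_gen_of_ne h, comp_zero]

/-- Generators of `a` bracket to zero with those of `b` and of its reverse, hence by Leibniz with
the matrix products that make up their bracket. -/
theorem gen_bracket_of_ne (hB : IsQuarticBracket c inc B) {a b : DoubleArrow V} (h₁ : a ≠ b)
    (h₂ : a ≠ b.bar) :
    gen c inc a ▷ _ ≫ S ◁ ((gen c inc b ⊗ₘ gen c inc b.bar) ≫ B) ≫ B = 0 := by
  have hD := ((isBiDerivation_iff B).1 hB.biDerivation).2.precomp (gen c inc a)
  have hb : hDualAt c a ◁ gen c inc b ≫ gen c inc a ▷ S ≫ B = 0 := by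
    rw [← MonoidalCategory.tensorHom_def'_assoc]
    exact hB.gen_gen_of_ne fun h => h₂ (by rw [h, DoubleArrow.bar_bar])
  have hb' : hDualAt c a ◁ gen c inc b.bar ≫ gen c inc a ▷ S ≫ B = 0 := by
    rw [← MonoidalCategory.tensorHom_def'_assoc]
    exact hB.gen_gen_of_ne fun h => h₁ (by
      rw [← a.bar_bar, ← h, DoubleArrow.bar_bar])
  refine pair_pair_pair_pair_pair_ext fun G _ _ p p' q q' r r' => ?_
  rw [pair_whiskerRight_assoc, pair_whiskerLeft_assoc, pair_tensorHom_assoc, hB.gen_gen_bar,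
    pair_zsmul, Preadditive.zsmul_comp, ← pair_whiskerRight_assoc, hD,
    hD.pair_matMul_eq_zero _ _ _ hb hb', hD.pair_matMul_eq_zero _ _ _ hb' hb]
  simp

/-- If `a` is `b` or its reverse, this is the `A, A, B` case up to rotation; otherwise all three
terms vanish separately. Any triple of arrows containing no involutive pair has zero inner brackets,
so this is the only case of substance. -/
theorem gen_gen_bar_jacobi (hB : IsQuarticBracket c inc B) (h : IsFreeCommMon inc)
    (a b : DoubleArrow V) {G : C} [ComonObj G]
    [IsCommComonObj G] (p : G ⟶ hDualAt c a) (q : G ⟶ hDualAt c b) (r : G ⟶ hDualAt c b.bar) :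
    pair (p ≫ gen c inc a) (pair (q ≫ gen c inc b) (r ≫ gen c inc b.bar)) ≫ jacobiator B = 0 := by
  by_cases h₁ : a = b
  · subst h₁
    rw [← pair_tensorHom, ← pair_tensorHom_assoc, hB.gen_gen_gen_bar h rfl, comp_zero]
  by_cases h₂ : a = b.bar
  · subst h₂
    rw [pair_jacobiator_rotate, pair_jacobiator_rotate, ← pair_tensorHom, ← pair_tensorHom_assoc,
      hB.gen_gen_gen_bar h b.bar_bar.symm, comp_zero]
  · have e₁ := pair p (pair q r) ≫= hB.gen_bracket_of_ne h₁ h₂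
    rw [pair_whiskerRight_assoc, pair_whiskerLeft_assoc, pair_tensorHom_assoc, comp_zero] at e₁
    rw [pair_jacobiator, e₁, hB.pair_gen_of_ne (a := b.bar) (by rwa [DoubleArrow.bar_bar]),
      hB.pair_gen_of_ne fun h => h₂ (by rw [h, DoubleArrow.bar_bar])]
    simp

theorem jacobiator_eq_zero (hB : IsQuarticBracket c inc B) (h : IsFreeCommMon inc) :
    jacobiator B = 0 := by
  refine h.jacobiator_eq_zero ((isBiDerivation_iff B).1 hB.biDerivation).2 (hB.antisymm h)
    (biproduct_tensor_tensor_ext fun a b d => ?_)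
  rw [comp_zero, tensorHom_comp_tensorHom_assoc, tensorHom_comp_tensorHom]
  change (gen c inc a ⊗ₘ (gen c inc b ⊗ₘ gen c inc d)) ≫ jacobiator B = 0
  refine pair_pair_ext' fun G _ _ p q r => ?_
  rw [pair_tensorHom_assoc, pair_tensorHom, comp_zero]
  by_cases h₁ : d = b.bar
  · subst h₁
    exact hB.gen_gen_bar_jacobi h _ _ _ _ _
  by_cases h₂ : a = d.bar
  · subst h₂
    rw [pair_jacobiator_rotate]
    exact hB.gen_gen_bar_jacobi h _ _ _ _ _
  by_cases h₃ : b = a.bar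
  · subst h₃
    rw [pair_jacobiator_rotate, pair_jacobiator_rotate]
    exact hB.gen_gen_bar_jacobi h _ _ _ _ _
  · rw [pair_jacobiator, hB.pair_gen_of_ne h₁, hB.pair_gen_of_ne h₂, hB.pair_gen_of_ne h₃]
    simp

theorem isPoissonBracket (hB : IsQuarticBracket c inc B) (h : IsFreeCommMon inc) :
    IsPoissonBracket B :=
  ⟨hB.biDerivation, hB.antisymm h, hB.jacobiator_eq_zero h⟩

end IsQuarticBracket

theorem existsUnique_isQuarticBracket (h : IsFreeCommMon inc) :
    ∃! B : S ⊗ S ⟶ S, IsQuarticBracket c inc B := by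
  obtain ⟨φ, hφ⟩ := exists_biproduct_tensor_desc (quarticComponent c inc)
  obtain ⟨B, hB, hBφ⟩ := h.exists_biDerivation φ
  refine ⟨B, ⟨hB, fun a b => ?_⟩, fun B' hB' => ?_⟩
  · rw [← hφ, ← hBφ, tensorHom_comp_tensorHom_assoc]
    rfl
  · rw [← sub_eq_zero]
    refine h.biDerivation_eq_zero ?_ (biproduct_tensor_ext fun a b => ?_)
    · have h₁ := (isBiDerivation_iff B).1 hB
      have h₂ := (isBiDerivation_iff B').1 hB'.biDerivation
      rw [isBiDerivation_iff, Preadditive.comp_sub]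
      exact ⟨h₂.1.sub h₁.1, h₂.2.sub h₁.2⟩
    · rw [Preadditive.comp_sub, hBφ, Preadditive.comp_sub, hφ, comp_zero,
        tensorHom_comp_tensorHom_assoc, sub_eq_zero]
      exact hB'.component a b

end Quartic

end QuarticPoisson

end

theorem mainTheorem6 {R : Type*} [CommRing R]
    {C : Type*} [Category C] [MonoidalCategory C] [SymmetricCategory C]
    [Preadditive C] [Linear R C] [MonoidalPreadditive C] [MonoidalLinear R C]
    [HasColimits C] [∀ X : C, PreservesColimits (tensorLeft X)]
    [∀ X : C, PreservesColimits (tensorRight X)]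
    {V : Type*} [Quiver V] [Finite V] [∀ i j : V, Finite (i ⟶ j)]
    (c : V → C) [∀ i, HasRightDual (c i)] :
    -- the free commutative monoid on `hᵛ` exists
    (∃ (S : C) (_ : MonObj S) (_ : IsCommMonObj S) (inc : QuarticPoisson.hDual c ⟶ S),
      QuarticPoisson.IsFreeCommMon inc) ∧
    -- on it, the quartic bi-derivation is well defined, and it is a Poisson bracket
    (∀ (S : C) [MonObj S] [IsCommMonObj S] (inc : QuarticPoisson.hDual c ⟶ S),
      QuarticPoisson.IsFreeCommMon inc →
      (∃! B : S ⊗ S ⟶ S, QuarticPoisson.IsQuarticBracket c inc B) ∧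
      ∀ B : S ⊗ S ⟶ S, QuarticPoisson.IsQuarticBracket c inc B →
        QuarticPoisson.IsPoissonBracket B) := by
  refine ⟨⟨_, _, _, _, QuarticPoisson.FreeComm.isFreeCommMon (QuarticPoisson.hDual c)⟩, ?_⟩
  intro S _ _ inc h
  exact ⟨QuarticPoisson.existsUnique_isQuarticBracket h, fun B hB => hB.isPoissonBracket h⟩
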